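/- **Theorem 3.2.** Let $k$ be a field, $R=k[x_1,\dots,x_r]$, and let $I$ be a monomial ideal of $R$ with $I\neq 0$ and $I\neq R$. For $n\ge 0$ let $$I^{(n)}=\bigcap_{\mathfrak p\in\operatorname{Min}(I)}\bigl(I^nR_{\mathfrak p}\cap R\bigr)$$ be the $n$-th symbolic power, where $\operatorname{Min}(I)$ is the set of minimal primes of $I$. For a nonzero homogeneous ideal $J$ let $d(J)$ be the maximal degree of a minimal homogeneous generator of $J$, i.e. the largest $j$ such that $(J/\mathfrak mJ)_j\ne 0$, where $\mathfrak m=(x_1,\dots,x_r)$. Let $Q_1,\dots,Q_s$ be the primary components of $I$ belonging to its minimal primes (in a minimal primary decomposition of $I$; they do not depend on its choice), so $s=|\operatorname{Min}(I)|$. Let $NP(Q_j)\subseteq\mathbb R^r$ be the Newton polyhedron of $Q_j$, the convex hull of $\{\alpha\in\mathbb N^r\mid x^\alpha\in Q_j\}$, and put $$SP(I)=NP(Q_1)\cap\dots\cap NP(Q_s),\qquad \delta(I)=\max\{v_1+\dots+v_r\mid v=(v_1,\dots,v_r)\text{ is a vertex of }SP(I)\}.$$ Then the maxima defining $d(I)$,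 $d(I^{(n)})$ (for all $n\ge 0$) and $\delta(I)$ exist, and $$\lim_{n\to\infty}\frac{d(I^{(n)})}{n}=\delta(I).$$ Moreover, with $\rho=r^2d(I)^{r-1}$, for all $n\ge 1$, $$\delta(I)\,n-r\rho\bigl(1+s(r-1)d(I)\bigr)\;\le\; d(I^{(n)})\;\le\;\delta(I)\,n+r+r(r-1)d(I).$$ -/

import Mathlib

open Filter Topology

namespace MonomialSymbolic

/-- The `n`-th symbolic power `I⁽ⁿ⁾ = ⋂ (Iⁿ R_p ∩ R)`, where `p` runs through the minimal primes
of `I`. -/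
noncomputable def symbolicPower {R : Type*} [CommRing R] (I : Ideal R) (n : ℕ) : Ideal R :=
  ⨅ p : I.minimalPrimes,
    haveI : (p : Ideal R).IsPrime := p.2.1.1
    ((I ^ n).map (algebraMap R (Localization.AtPrime (p : Ideal R)))).comap
      (algebraMap R (Localization.AtPrime (p : Ideal R)))

/-- The components `Q` of minimal primary decompositions of `I` whose radical is a minimal prime
of `I`. -/
def minimalPrimaryComponents {R : Type*} [CommRing R] (I : Ideal R) : Set (Ideal R) :=
  {Q | ∃ t : Finset (Ideal R), Submodule.IsMinimalPrimaryDecomposition I t ∧ Q ∈ t ∧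
    Q.radical ∈ I.minimalPrimes}

variable {k : Type*} [Field k] {r : ℕ}

/-- An ideal of `k[x₁, …, x_r]` is monomial if it is generated by monomials. -/
def IsMonomialIdeal (I : Ideal (MvPolynomial (Fin r) k)) : Prop :=
  ∃ S : Set (Fin r →₀ ℕ), I = Ideal.span ((fun α => MvPolynomial.monomial α (1 : k)) '' S)

/-- The degrees of the minimal homogeneous generators of a homogeneous ideal `J`: the degrees `j`
in which there is a form of `J` that does not lie in `𝔪 J`, that is, `(J / 𝔪 J)_j ≠ 0`, where
`𝔪 = (x₁, …, x_r)`. -/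
def minGenDegrees (J : Ideal (MvPolynomial (Fin r) k)) : Set ℕ :=
  {j | ∃ f ∈ J, f.IsHomogeneous j ∧ f ∉ MvPolynomial.idealOfVars (Fin r) k * J}

/-- `d(J)`, the maximal degree of a minimal homogeneous generator of `J`. -/
noncomputable def maxGenDegree (J : Ideal (MvPolynomial (Fin r) k)) : ℕ :=
  sSup (minGenDegrees J)

/-- The Newton polyhedron `NP(Q)`: the convex hull in `ℝʳ` of the exponents of the monomials
in `Q`. -/
def newtonPolyhedron (Q : Ideal (MvPolynomial (Fin r) k)) : Set (Fin r → ℝ) :=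
  convexHull ℝ {v | ∃ α : Fin r →₀ ℕ, MvPolynomial.monomial α (1 : k) ∈ Q ∧
    v = fun i => (α i : ℝ)}

/-- The symbolic polyhedron `SP(I)`: the intersection of the Newton polyhedra of the primary
components of `I` that belong to the minimal primes of `I`. -/
def symbolicPolyhedron (I : Ideal (MvPolynomial (Fin r) k)) : Set (Fin r → ℝ) :=
  ⋂ Q ∈ minimalPrimaryComponents I, newtonPolyhedron Q

/-- The coordinate sums `|v| = v₁ + ⋯ + v_r` of the vertices `v` of `SP(I)`. -/
def vertexSums (I : Ideal (MvPolynomial (Fin r) k)) : Set ℝ :=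
  {c | ∃ v ∈ (symbolicPolyhedron I).extremePoints ℝ, c = ∑ i, v i}

/-- `δ(I)`, the largest coordinate sum of a vertex of `SP(I)`. -/
noncomputable def delta (I : Ideal (MvPolynomial (Fin r) k)) : ℝ :=
  sSup (vertexSums I)

end MonomialSymbolic

/-! A minimal prime of `I` is generated by a set `F` of variables, and contracting a monomial ideal
from the localization there sets the variables outside `F` to `1` (`contraction_spanMonomials`).
With `G p` the restrictions to `F p` of the exponents of the minimal generators of `I`, the
component `Q_p` is generated by `G p`, `I⁽ⁿ⁾` is the intersection of the `Q_p ^ n`, and `SP(I)` is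
the intersection of the polyhedra `conv (G p) + ℝ≥0^r`. What remains is combinatorics of exponents.
By minimality of `F p`, each variable in `F p` has a pure power of exponent at most `d = d(I)` in `G
p`, and the other variables do not occur there.

The bridge is Carathéodory with `r` points: if `x` lies in the polyhedron and `α ≥ (n + r - 1) x`,
rounding the coefficients down still leaves `n` generators whose sum is below `α`
(`mem_upperPow_of_smul_le`).

Upper bound (`sum_le_of_minimal`): for a minimal exponent `α` of `I⁽ⁿ⁾`, `α / n` dominates a convex
combination `z` of vertices. If `α i > n z i + 1 + (r - 1) d`, the excess pays for `r - 1` pure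
powers of `x_i`, so `α - e_i` is still in `I⁽ⁿ⁾`.

Lower bound (`exists_minimal_le_sum`): round `(n + r - 1) v` up to `α` for a vertex `v`, and take a
minimal `β ≤ α`. Since `v` cannot be lowered in a positive coordinate `i`, an almost tight
inequality of some polyhedron involves `i`. It forces `α i - β i ≤ K²` with `K = 1 + (r - 1) d`. -/

namespace MonomialSymbolic

open scoped Pointwise

/-! ### Polyhedra of the form convex hull plus orthant, and their vertices -/

section Convex

variable {r : ℕ}

/-- The points of `ℝʳ` that dominate a point of the convex hull of `K`. -/
def upperHull (K : Set (Fin r → ℝ)) : Set (Fin r → ℝ) :=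
  {x | ∃ y ∈ convexHull ℝ K, y ≤ x}

lemma upperHull_eq_add (K : Set (Fin r → ℝ)) :
    upperHull K = convexHull ℝ K + Set.Ici 0 := by
  ext x
  rw [Set.mem_add]
  constructor
  · rintro ⟨y, hy, hyx⟩
    exact ⟨y, hy, x - y, sub_nonneg.2 hyx, by simp⟩
  · rintro ⟨y, hy, c, hc, rfl⟩
    exact ⟨y, hy, le_add_of_nonneg_right hc⟩

lemma convex_upperHull (K : Set (Fin r → ℝ)) : Convex ℝ (upperHull K) := by
  rw [upperHull_eq_add]
  exact (convex_convexHull ℝ K).add (convex_Ici 0)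

lemma isClosed_upperHull {K : Set (Fin r → ℝ)} (hK : K.Finite) : IsClosed (upperHull K) := by
  rw [upperHull_eq_add]
  exact isClosed_Ici.add_left_of_isCompact (hK.isCompact_convexHull ℝ)

lemma upperHull_mono_right {K : Set (Fin r → ℝ)} {x y : Fin r → ℝ} (hx : x ∈ upperHull K)
    (h : x ≤ y) : y ∈ upperHull K := by
  obtain ⟨z, hz, hzx⟩ := hx
  exact ⟨z, hz, hzx.trans h⟩

lemma subset_upperHull (K : Set (Fin r → ℝ)) : K ⊆ upperHull K :=
  fun x hx => ⟨x, subset_convexHull ℝ K hx, le_rfl⟩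

lemma upperHull_nonneg {K : Set (Fin r → ℝ)} (hK : K ⊆ Set.Ici 0) : upperHull K ⊆ Set.Ici 0 := by
  rintro x ⟨y, hy, hyx⟩
  exact (convexHull_min hK (convex_Ici 0) hy : (0 : Fin r → ℝ) ≤ y).trans hyx

lemma exists_separating_of_notMem_upperHull {K : Set (Fin r → ℝ)} (hK : K.Finite)
    (hne : K.Nonempty) {x : Fin r → ℝ} (hx : x ∉ upperHull K) :
    ∃ (a : Fin r → ℝ) (u : ℝ), (∀ i, 0 ≤ a i) ∧ ∑ i, a i * x i < u ∧
      ∀ y ∈ K, u ≤ ∑ i, a i * y i := by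
  obtain ⟨f, u, hfx, hf⟩ :=
    geometric_hahn_banach_point_closed (convex_upperHull K) (isClosed_upperHull hK) hx
  have hsum : ∀ y : Fin r → ℝ, f y = ∑ i, f (Pi.single i 1) * y i := by
    intro y
    conv_lhs => rw [pi_eq_sum_univ' y]
    simp only [map_sum, map_smul, smul_eq_mul]
    refine Finset.sum_congr rfl fun i _ => ?_
    rw [mul_comm]
  refine ⟨fun i => f (Pi.single i 1), u, fun i => ?_, by rw [← hsum]; exact hfx, fun y hy => by
    rw [← hsum]; exact (hf y (subset_upperHull K hy)).le⟩
  by_contra! hneg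
  obtain ⟨v, hv⟩ := hne
  have hpos : 0 < -f (Pi.single i 1) := by linarith
  have huv := hf v (subset_upperHull K hv)
  -- With a negative coefficient, moving this far from `v` along `e_i` stays in the upper hull but
  -- brings `f` down to exactly `u`.
  have ht : 0 ≤ (f v - u) / -f (Pi.single i 1) := by
    apply div_nonneg <;> linarith
  have := hf (v + ((f v - u) / -f (Pi.single i 1)) • Pi.single i 1)
    (upperHull_mono_right (subset_upperHull K hv)
      (le_add_of_nonneg_right (smul_nonneg ht (Pi.single_nonneg.2 zero_le_one))))
  rw [map_add, map_smul, smul_eq_mul, div_neg, neg_mul, div_mul_cancel₀ _ hneg.ne] at this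
  linarith

/-- Strict positivity of `a` makes sublevel sets in the orthant compact, so the functional attains
its minimum on a compact exposed face. Krein–Milman gives that face an extreme point, which is
extreme in `S`. -/
lemma exists_mem_extremePoints_sum_le {S : Set (Fin r → ℝ)} (hS : IsClosed S)
    (h0 : S ⊆ Set.Ici 0) {a : Fin r → ℝ} (ha : ∀ i, 0 < a i) {x : Fin r → ℝ} (hx : x ∈ S) :
    ∃ v ∈ S.extremePoints ℝ, ∑ i, a i * v i ≤ ∑ i, a i * x i := by
  let l : StrongDual ℝ (Fin r → ℝ) := ∑ i, a i • ContinuousLinearMap.proj i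
  have hl : ∀ y, l y = ∑ i, a i * y i := by
    intro y
    simp [l]
  have hK : IsCompact (S ∩ {y | l y ≤ l x}) := by
    refine Metric.isCompact_of_isClosed_isBounded
      (hS.inter (isClosed_le l.continuous continuous_const)) ?_
    refine (Metric.isBounded_Icc (0 : Fin r → ℝ) (fun i => l x / a i)).subset ?_
    rintro y ⟨hyS, hy⟩
    have hy0 : 0 ≤ y := h0 hyS
    refine ⟨hy0, fun i => ?_⟩
    rw [le_div_iff₀ (ha i), mul_comm]
    refine le_trans ?_ hy
    rw [hl]
    exact Finset.single_le_sum (f := fun i => a i * y i)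
      (fun j _ => mul_nonneg (ha j).le (hy0 j)) (Finset.mem_univ i)
  obtain ⟨y, ⟨hyS, hyx⟩, hy⟩ := hK.exists_isMinOn ⟨x, hx, le_refl (l x)⟩ l.continuous.continuousOn
  have hmin : ∀ z ∈ S, l y ≤ l z := by
    intro z hz
    rcases le_total (l z) (l x) with h | h
    · exact hy ⟨hz, h⟩
    · exact (show l y ≤ l x from hyx).trans h
  -- `toExposed` selects maximizers, hence the sign.
  have hexp : IsExposed ℝ S ((-l).toExposed S) := ContinuousLinearMap.toExposed.isExposed
  have hcomp : IsCompact ((-l).toExposed S) := by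
    refine hK.of_isClosed_subset (hexp.isClosed hS) ?_
    rintro z ⟨hz, hz'⟩
    have := hz' x hx
    simp only [neg_apply, neg_le_neg_iff] at this
    exact ⟨hz, this⟩
  obtain ⟨v, hv⟩ := hcomp.extremePoints_nonempty ⟨y, hyS, fun z hz => by
    simpa using hmin z hz⟩
  refine ⟨v, hexp.isExtreme.extremePoints_subset_extremePoints hv, ?_⟩
  have := hv.1.2 x hx
  simp only [neg_apply, neg_le_neg_iff, hl] at this
  exact this

lemma subset_upperHull_extremePoints {S : Set (Fin r → ℝ)} (hS : IsClosed S)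
    (h0 : S ⊆ Set.Ici 0) (hfin : (S.extremePoints ℝ).Finite) :
    S ⊆ upperHull (S.extremePoints ℝ) := by
  intro x hx
  by_contra hnot
  obtain ⟨v₀, hv₀, -⟩ := exists_mem_extremePoints_sum_le hS h0 (a := 1) (by simp) hx
  obtain ⟨a, u, ha, hax, hav⟩ := exists_separating_of_notMem_upperHull hfin ⟨v₀, hv₀⟩ hnot
  have hx0 : ∀ i, 0 ≤ x i := h0 hx
  have hxs : 0 ≤ ∑ i, x i := Finset.sum_nonneg fun i _ => hx0 i
  -- The separating `a` is only nonnegative; adding `ε` makes it strictly positive. This `ε` gives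
  -- `(a + ε) · x = u - ε < u`, so the vertex found below contradicts `u ≤ a · v`.
  set ε : ℝ := (u - ∑ i, a i * x i) / (1 + ∑ i, x i) with hε
  have hεpos : 0 < ε := by
    apply div_pos <;> linarith
  obtain ⟨v, hv, hvx⟩ := exists_mem_extremePoints_sum_le hS h0 (a := fun i => a i + ε)
    (fun i => by linarith [ha i]) hx
  have hv0 : ∀ i, 0 ≤ v i := h0 hv.1
  have hvs : 0 ≤ ∑ i, v i := Finset.sum_nonneg fun i _ => hv0 i
  simp only [add_mul, Finset.sum_add_distrib, ← Finset.mul_sum] at hvx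
  have h1 := hav v hv
  have h2 : ε * (1 + ∑ i, x i) = u - ∑ i, a i * x i := by
    rw [hε]; field_simp
  nlinarith [mul_nonneg hεpos.le hvs]

lemma eventually_nonneg_sub_mul {a b : ℝ} (ha : 0 ≤ a) (h : a = 0 → b = 0) :
    ∀ᶠ ε in 𝓝[>] (0 : ℝ), 0 ≤ a - ε * (b - a) := by
  rcases ha.eq_or_lt with h0 | hpos
  · rw [h h0.symm, ← h0]
    simp
  · have : Tendsto (fun ε : ℝ => a - ε * (b - a)) (𝓝 0) (𝓝 (a - 0 * (b - a))) :=
      Continuous.tendsto (by fun_prop) 0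
    rw [zero_mul, sub_zero] at this
    exact ((this.eventually (lt_mem_nhds hpos)).filter_mono nhdsWithin_le_nhds).mono
      fun ε h => h.le

/-- Each point of `S` has convex weights and slacks for every `j`. Two points with the same pattern
of zeros can be prolonged slightly beyond one another inside `S`, so an extreme point is determined
by its pattern, and there are finitely many patterns. -/
lemma finite_extremePoints_iInter_upperHull {ι : Type*} [Finite ι]
    (K : ι → Finset (Fin r → ℝ)) :
    ((⋂ j, upperHull (K j : Set (Fin r → ℝ))).extremePoints ℝ).Finite := by
  set S := ⋂ j, upperHull (K j : Set (Fin r → ℝ)) with hS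
  have hrep : ∀ (x : S) (j : ι), ∃ w : (Fin r → ℝ) → ℝ, (∀ y ∈ K j, 0 ≤ w y) ∧
      ∑ y ∈ K j, w y = 1 ∧ ∑ y ∈ K j, w y • y ≤ x := by
    rintro ⟨x, hx⟩ j
    obtain ⟨y, hy, hyx⟩ := Set.mem_iInter.1 hx j
    obtain ⟨w, hw0, hw1, hw⟩ := Finset.mem_convexHull'.1 hy
    exact ⟨w, hw0, hw1, hw.le.trans hyx⟩
  choose w hw0 hw1 hwx using hrep
  let c : S → ι → Fin r → ℝ := fun x j => x - ∑ y ∈ K j, w x j y • y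
  have hc0 : ∀ x j i, 0 ≤ c x j i := fun x j i => sub_nonneg.2 (hwx x j i)
  let data : S → (j : ι) → Set (K j) × Set (Fin r) := fun x j =>
    ({y | w x j y = 0}, {i | c x j i = 0})
  have hmem : ∀ x x' : S, data x = data x' →
      ∃ ε > (0 : ℝ), (x : Fin r → ℝ) - ε • ((x' : Fin r → ℝ) - x) ∈ S := by
    intro x x' h
    have hw : ∀ᶠ ε in 𝓝[>] (0 : ℝ), ∀ (j : ι) (y : K j), 0 ≤ w x j y - ε * (w x' j y - w x j y) := by
      rw [eventually_all]; intro j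
      rw [eventually_all]; intro y
      refine eventually_nonneg_sub_mul (hw0 x j y y.2) fun h0 => ?_
      have h1 : (data x j).1 = (data x' j).1 := by rw [h]
      exact h1.subset (show y ∈ (data x j).1 from h0)
    have hc : ∀ᶠ ε in 𝓝[>] (0 : ℝ), ∀ (j : ι) (i : Fin r), 0 ≤ c x j i - ε * (c x' j i - c x j i) := by
      rw [eventually_all]; intro j
      rw [eventually_all]; intro i
      refine eventually_nonneg_sub_mul (hc0 x j i) fun h0 => ?_
      have h1 : (data x j).2 = (data x' j).2 := by rw [h]
      exact h1.subset (show i ∈ (data x j).2 from h0)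
    obtain ⟨ε, ⟨h1, h2⟩, hε⟩ := ((hw.and hc).and self_mem_nhdsWithin).exists
    refine ⟨ε, hε, Set.mem_iInter.2 fun j => ?_⟩
    refine ⟨∑ y ∈ K j, (w x j y - ε * (w x' j y - w x j y)) • y, Finset.mem_convexHull'.2
      ⟨fun y => w x j y - ε * (w x' j y - w x j y), fun y hy => h1 j ⟨y, hy⟩, ?_, rfl⟩, fun i => ?_⟩
    · rw [Finset.sum_sub_distrib, ← Finset.mul_sum, Finset.sum_sub_distrib, hw1, hw1]
      simp
    · have := h2 j i
      simp only [c, Pi.sub_apply, Finset.sum_apply, Pi.smul_apply, smul_eq_mul, sub_mul, mul_sub,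
        Finset.sum_sub_distrib, mul_assoc, ← Finset.mul_sum] at this ⊢
      linarith
  have hinj : Set.InjOn data {x : S | (x : Fin r → ℝ) ∈ S.extremePoints ℝ} := by
    intro x hx x' _ h
    obtain ⟨ε, hε, hmemε⟩ := hmem x x' h
    have := (mem_extremePoints.1 hx).2 _ hmemε _ x'.2 ?_
    · exact Subtype.ext this.2.symm
    -- `x` is this combination of `x - ε (x' - x)` and `x'`.
    · refine ⟨1 / (1 + ε), ε / (1 + ε), by positivity, by positivity, by field_simp, ?_⟩
      ext i
      simp only [Pi.add_apply, Pi.smul_apply, Pi.sub_apply, smul_eq_mul]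
      field_simp
      ring
  have hfin : {x : S | (x : Fin r → ℝ) ∈ S.extremePoints ℝ}.Finite :=
    Set.Finite.of_finite_image (Set.toFinite _) hinj
  refine (hfin.image Subtype.val).subset fun x hx => ⟨⟨x, hx.1⟩, hx, rfl⟩

/-- An affine relation imposes `r + 1` equations. Since only `0 ≤ ∑ μ y` is needed, the equation of
coordinate `i₀` is traded for a sign, which `μ ↦ -μ` can adjust; `r` equations remain. -/
lemma exists_relation_of_lt_card {E : Finset (Fin r → ℝ)} (hr : 0 < r) (hE : r < E.card) :
    ∃ μ : (Fin r → ℝ) → ℝ, ∑ y ∈ E, μ y = 0 ∧ 0 ≤ ∑ y ∈ E, μ y • y ∧ ∃ y ∈ E, 0 < μ y := by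
  let i₀ : Fin r := ⟨0, hr⟩
  let L : (E → ℝ) →ₗ[ℝ] (Fin r → ℝ) :=
    { toFun := fun μ i => if i = i₀ then ∑ y, μ y else ∑ y, μ y * (y : Fin r → ℝ) i
      map_add' := by
        intro μ ν
        ext i
        simp only [Pi.add_apply, add_mul, Finset.sum_add_distrib]
        split_ifs <;> rfl
      map_smul' := by
        intro c μ
        ext i
        simp only [Pi.smul_apply, smul_eq_mul, mul_assoc, ← Finset.mul_sum, RingHom.id_apply]
        split_ifs <;> rfl }
  have hker : LinearMap.ker L ≠ ⊥ := LinearMap.ker_ne_bot_of_finrank_lt (by simpa using hE)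
  obtain ⟨μ, hμL, hμ⟩ := Submodule.exists_mem_ne_zero_of_ne_bot hker
  have hsum : ∑ y, μ y = 0 := by
    have := congrFun (LinearMap.mem_ker.1 hμL) i₀
    simpa [L] using this
  have hoff : ∀ i ≠ i₀, ∑ y, μ y * (y : Fin r → ℝ) i = 0 := by
    intro i hi
    have := congrFun (LinearMap.mem_ker.1 hμL) i
    simpa [L, hi] using this
  wlog hpos : 0 ≤ ∑ y, μ y * (y : Fin r → ℝ) i₀ generalizing μ
  · exact this (-μ) (neg_mem hμL) (neg_ne_zero.2 hμ) (by simpa using hsum)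
      (fun i hi => by simpa using hoff i hi) (by
        simp only [Pi.neg_apply, neg_mul, Finset.sum_neg_distrib]; linarith)
  classical
  let ν : (Fin r → ℝ) → ℝ := fun y => if h : y ∈ E then μ ⟨y, h⟩ else 0
  have hν : ∀ y : E, ν y = μ y := fun y => by simp [ν]
  refine ⟨ν, ?_, fun i => ?_, ?_⟩
  · rw [← Finset.sum_coe_sort]
    simpa only [hν] using hsum
  · rw [← Finset.sum_coe_sort]
    simp only [hν, Finset.sum_apply, Pi.smul_apply, smul_eq_mul, Pi.zero_apply]
    by_cases hi : i = i₀
    · rw [hi]; exact hpos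
    · rw [hoff i hi]
  · by_contra! hle
    apply hμ
    ext y
    refine (Finset.sum_eq_zero_iff_of_nonpos (fun y _ => ?_)).1 hsum y (Finset.mem_univ y)
    rw [← hν]
    exact hle y y.2

/-- Carathéodory's theorem for upper hulls: `r` points are enough in `ℝʳ`. -/
lemma exists_card_le_of_mem_upperHull (hr : 0 < r) {K : Set (Fin r → ℝ)} {x : Fin r → ℝ}
    (hx : x ∈ upperHull K) : ∃ (E : Finset (Fin r → ℝ)) (w : (Fin r → ℝ) → ℝ), ↑E ⊆ K ∧
      E.card ≤ r ∧ (∀ y ∈ E, 0 ≤ w y) ∧ ∑ y ∈ E, w y = 1 ∧ ∑ y ∈ E, w y • y ≤ x := by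
  have key : ∀ (m : ℕ) (E : Finset (Fin r → ℝ)) (w : (Fin r → ℝ) → ℝ), E.card = m → ↑E ⊆ K →
      (∀ y ∈ E, 0 ≤ w y) → ∑ y ∈ E, w y = 1 → ∑ y ∈ E, w y • y ≤ x →
      ∃ (E : Finset (Fin r → ℝ)) (w : (Fin r → ℝ) → ℝ), ↑E ⊆ K ∧
      E.card ≤ r ∧ (∀ y ∈ E, 0 ≤ w y) ∧ ∑ y ∈ E, w y = 1 ∧ ∑ y ∈ E, w y • y ≤ x := by
    classical
    intro m
    induction m with
    | zero =>
      intro E w hm hEK h0 h1 hs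
      exact ⟨E, w, hEK, by omega, h0, h1, hs⟩
    | succ m ih =>
      intro E w hm hEK h0 h1 hs
      rcases le_or_gt E.card r with hle | hlt
      · exact ⟨E, w, hEK, hle, h0, h1, hs⟩
      obtain ⟨μ, hμ0, hμs, y₁, hy₁, hμy₁⟩ := exists_relation_of_lt_card hr hlt
      obtain ⟨y₀, hy₀, hmin⟩ := Finset.exists_min_image {y ∈ E | 0 < μ y} (fun y => w y / μ y)
        ⟨y₁, by simp [hy₁, hμy₁]⟩
      rw [Finset.mem_filter] at hy₀
      -- The largest multiple of `μ` that can be subtracted with weights staying nonnegative. It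
      -- kills the weight of `y₀`, and the weighted sum only decreases because `∑ μ y ≥ 0`.
      set θ := w y₀ / μ y₀ with hθ
      have hθ0 : 0 ≤ θ := div_nonneg (h0 _ hy₀.1) hy₀.2.le
      have hzero : w y₀ - θ * μ y₀ = 0 := by
        rw [hθ, div_mul_cancel₀ _ hy₀.2.ne', sub_self]
      refine ih (E.erase y₀) (fun y => w y - θ * μ y) ?_ ?_ ?_ ?_ ?_
      · rw [Finset.card_erase_of_mem hy₀.1, hm]; rfl
      · exact (Finset.coe_subset.2 (Finset.erase_subset _ _)).trans hEK
      · intro y hy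
        have hyE := Finset.mem_of_mem_erase hy
        rcases le_or_gt (μ y) 0 with h | h
        · have := h0 y hyE
          nlinarith [mul_nonneg hθ0 (neg_nonneg.2 h)]
        · have := hmin y (by simp [hyE, h])
          rw [le_div_iff₀ h] at this
          linarith
      · rw [Finset.sum_erase (f := fun y => w y - θ * μ y) _ hzero,
          Finset.sum_sub_distrib, ← Finset.mul_sum, hμ0, h1]
        simp
      · rw [Finset.sum_erase _ (by simp only [hzero, zero_smul])]
        simp only [sub_smul, Finset.sum_sub_distrib, mul_smul, ← Finset.smul_sum]
        exact (sub_le_self _ (smul_nonneg hθ0 hμs)).trans hs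
  obtain ⟨y, hy, hyx⟩ := hx
  obtain ⟨ι, _, w, z, hw0, hw1, hz, rfl⟩ := mem_convexHull_iff_exists_fintype.1 hy
  classical
  refine key _ (Finset.univ.image z) (fun y => ∑ i with z i = y, w i) rfl ?_ ?_ ?_ ?_
  · intro y hy
    obtain ⟨i, -, rfl⟩ := Finset.mem_image.1 (Finset.mem_coe.1 hy)
    exact hz i
  · exact fun y _ => Finset.sum_nonneg fun i _ => hw0 i
  · rw [← hw1]
    exact Finset.sum_fiberwise_of_maps_to (fun i _ => Finset.mem_image_of_mem z (Finset.mem_univ i)) _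
  · refine le_trans (le_of_eq ?_) hyx
    rw [← Finset.sum_fiberwise_of_maps_to (t := Finset.univ.image z) (g := z)
      (fun i _ => Finset.mem_image_of_mem z (Finset.mem_univ i))]
    refine Finset.sum_congr rfl fun y _ => ?_
    rw [Finset.sum_smul]
    exact Finset.sum_congr rfl fun i hi => by rw [(Finset.mem_filter.1 hi).2]

end Convex

/-! ### Exponents of powers against polyhedra: the two degree bounds -/

section Exponents

variable {r : ℕ}

/-- An exponent vector as a point of `ℝʳ`. -/
def realExp (α : Fin r →₀ ℕ) : Fin r → ℝ := fun i => (α i : ℝ)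

/-- The exponents that dominate a sum of `n` elements of `G`. -/
def upperPow (G : Set (Fin r →₀ ℕ)) (n : ℕ) : Set (Fin r →₀ ℕ) :=
  {α | ∃ β ∈ n • G, β ≤ α}

lemma upperPow_mono_right {G : Set (Fin r →₀ ℕ)} {n : ℕ} {α β : Fin r →₀ ℕ}
    (hα : α ∈ upperPow G n) (h : α ≤ β) : β ∈ upperPow G n := by
  obtain ⟨γ, hγ, hγα⟩ := hα
  exact ⟨γ, hγ, hγα.trans h⟩

lemma realExp_image_nonneg (G : Set (Fin r →₀ ℕ)) : realExp '' G ⊆ Set.Ici 0 := by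
  rintro _ ⟨g, -, rfl⟩ i
  exact Nat.cast_nonneg _

lemma le_of_mem_convexHull {K : Set (Fin r → ℝ)} {i : Fin r} {c : ℝ} (h : ∀ y ∈ K, y i ≤ c)
    {y : Fin r → ℝ} (hy : y ∈ convexHull ℝ K) : y i ≤ c :=
  convexHull_min h (convex_halfSpace_le (LinearMap.proj i : (Fin r → ℝ) →ₗ[ℝ] ℝ).isLinear c) hy

lemma le_sum_of_mem_convexHull {K : Set (Fin r → ℝ)} {a : Fin r → ℝ} {c : ℝ}
    (h : ∀ y ∈ K, c ≤ ∑ i, a i * y i) {y : Fin r → ℝ} (hy : y ∈ convexHull ℝ K) :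
    c ≤ ∑ i, a i * y i := by
  let l : (Fin r → ℝ) →ₗ[ℝ] ℝ := ∑ i, a i • LinearMap.proj i
  have hl : ∀ y, l y = ∑ i, a i * y i := fun y => by simp [l]
  have := convexHull_min (t := {y | c ≤ l y}) (fun y hy => by
    change c ≤ l y
    rw [hl]; exact h y hy) (convex_halfSpace_ge l.isLinear c) hy
  rw [← hl]; exact this

lemma sum_le_of_mem_convexHull {K : Set (Fin r → ℝ)} {c : ℝ}
    (h : ∀ y ∈ K, ∑ i, y i ≤ c) {y : Fin r → ℝ} (hy : y ∈ convexHull ℝ K) :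
    ∑ i, y i ≤ c := by
  have := le_sum_of_mem_convexHull (a := fun _ => -1) (c := -c)
    (fun y hy => by simpa using h y hy) hy
  simpa using this

lemma realExp_mem_smul_convexHull {G : Set (Fin r →₀ ℕ)} (hG : G.Nonempty) {n : ℕ}
    {β : Fin r →₀ ℕ} (hβ : β ∈ n • G) :
    realExp β ∈ (n : ℝ) • convexHull ℝ (realExp '' G) := by
  induction n generalizing β with
  | zero =>
    rw [zero_nsmul, Set.mem_zero] at hβ
    rw [Nat.cast_zero, Set.zero_smul_set (hG.image _).convexHull, hβ]
    ext i
    simp [realExp]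
  | succ n ih =>
    rw [succ_nsmul, Set.mem_add] at hβ
    obtain ⟨γ, hγ, g, hg, rfl⟩ := hβ
    rw [Nat.cast_add, Nat.cast_one, (convex_convexHull ℝ _).add_smul n.cast_nonneg zero_le_one,
      one_smul]
    refine ⟨realExp γ, ih hγ, realExp g, subset_convexHull ℝ _ ⟨g, hg, rfl⟩, ?_⟩
    ext i
    simp [realExp]

lemma sum_nsmul_mem_nsmul {κ : Type*} {G : Set (Fin r →₀ ℕ)} {E : Finset κ} {m : κ → ℕ}
    {g : κ → Fin r →₀ ℕ} (hg : ∀ y ∈ E, g y ∈ G) :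
    ∑ y ∈ E, m y • g y ∈ (∑ y ∈ E, m y) • G := by
  classical
  induction E using Finset.induction_on with
  | empty => simp
  | insert a E ha ih =>
    rw [Finset.sum_insert ha, Finset.sum_insert ha, add_nsmul]
    exact Set.add_mem_add (Set.nsmul_mem_nsmul (hg a (Finset.mem_insert_self _ _)))
      (ih fun y hy => hg y (Finset.mem_insert_of_mem hy))

lemma upperPow_anti {G : Set (Fin r →₀ ℕ)} {m n : ℕ} (h : n ≤ m) :
    upperPow G m ⊆ upperPow G n := by
  rintro α ⟨β, hβ, hβα⟩
  obtain ⟨k, rfl⟩ := Nat.exists_eq_add_of_le h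
  rw [add_nsmul, Set.mem_add] at hβ
  obtain ⟨γ, hγ, γ', -, rfl⟩ := hβ
  exact ⟨γ, hγ, le_self_add.trans hβα⟩

lemma mem_upperPow_of_smul_le (hr : 0 < r) {G : Set (Fin r →₀ ℕ)} {n : ℕ}
    {α : Fin r →₀ ℕ} {x : Fin r → ℝ} (hx : x ∈ upperHull (realExp '' G))
    (h : ((n : ℝ) + (r - 1)) • x ≤ realExp α) : α ∈ upperPow G n := by
  obtain ⟨E, w, hE, hcard, hw0, hw1, hwx⟩ := exists_card_le_of_mem_upperHull hr hx
  have hE' : ∀ y ∈ E, ∃ g ∈ G, realExp g = y := fun y hy => hE hy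
  choose! g hg hgE using hE'
  have hr1 : (1 : ℝ) ≤ r := by exact_mod_cast hr
  set N : ℝ := n + (r - 1) with hN
  have hN0 : 0 ≤ N := by
    have : (0 : ℝ) ≤ n := n.cast_nonneg
    linarith
  have hne : E.Nonempty := by
    rw [Finset.nonempty_iff_ne_empty]
    rintro rfl
    simp at hw1
  -- Each floor loses less than `1` and there are at most `r` of them, so the sum exceeds `N - r = n
  -- - 1`.
  have hm : n ≤ ∑ y ∈ E, ⌊N * w y⌋₊ := by
    have h1 : ∑ y ∈ E, (N * w y - 1) < ∑ y ∈ E, (⌊N * w y⌋₊ : ℝ) :=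
      Finset.sum_lt_sum_of_nonempty hne fun y _ => by linarith [Nat.lt_floor_add_one (N * w y)]
    rw [Finset.sum_sub_distrib, ← Finset.mul_sum, hw1] at h1
    have h2 : (E.card : ℝ) ≤ r := by exact_mod_cast hcard
    have h3 : (n : ℝ) < (∑ y ∈ E, ⌊N * w y⌋₊ : ℕ) + 1 := by
      push_cast
      simp only [Finset.sum_const, nsmul_eq_mul, mul_one] at h1
      linarith
    have h4 : n < (∑ y ∈ E, ⌊N * w y⌋₊) + 1 := by exact_mod_cast h3
    omega
  refine upperPow_anti hm ⟨_, sum_nsmul_mem_nsmul (m := fun y => ⌊N * w y⌋₊) (g := g)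
    hg, fun i => ?_⟩
  have h1 := h i
  have h2 := mul_le_mul_of_nonneg_left (hwx i) hN0
  simp only [Finset.sum_apply, Pi.smul_apply, smul_eq_mul, Finset.mul_sum] at h1 h2
  have h3 : ∑ y ∈ E, (⌊N * w y⌋₊ : ℝ) * (g y i : ℝ) ≤ ∑ y ∈ E, N * (w y * y i) := by
    refine Finset.sum_le_sum fun y hy => ?_
    have : y i = g y i := (congrFun (hgE y hy) i).symm
    rw [this, ← mul_assoc]
    exact mul_le_mul_of_nonneg_right (Nat.floor_le (mul_nonneg hN0 (hw0 y hy))) (Nat.cast_nonneg _)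
  have h4 : ((∑ y ∈ E, ⌊N * w y⌋₊ * g y i : ℕ) : ℝ) ≤ (α i : ℝ) := by
    push_cast
    exact (h3.trans h2).trans h1
  simpa [Finsupp.finsetSum_apply] using (Nat.cast_le (α := ℝ)).1 h4

lemma exists_mem_convexHull_smul_le {G : Set (Fin r →₀ ℕ)} (hG : G.Nonempty) {n : ℕ}
    {α : Fin r →₀ ℕ} (hα : α ∈ upperPow G n) :
    ∃ y ∈ convexHull ℝ (realExp '' G), (n : ℝ) • y ≤ realExp α := by
  obtain ⟨β, hβ, hβα⟩ := hα
  obtain ⟨y, hy, hyβ⟩ := realExp_mem_smul_convexHull hG hβ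
  refine ⟨y, hy, fun i => ?_⟩
  have : ((n : ℝ) • y) i = β i := congrFun hyβ i
  rw [this]
  exact Nat.cast_le.2 (hβα i)

/-- A point outside the upper hull of a set of exponents is cut off by a functional whose
coefficients relative to its lower bound on the hull are at most `1`. -/
lemma exists_truncated_separating {G : Set (Fin r →₀ ℕ)} (hfin : G.Finite) (hG : G.Nonempty)
    {x : Fin r → ℝ} (hx0 : 0 ≤ x) (hx : x ∉ upperHull (realExp '' G)) :
    ∃ a : Fin r → ℝ, (∀ i, 0 ≤ a i) ∧ (∀ i, a i ≤ 1) ∧ ∑ i, a i * x i < 1 ∧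
      ∀ g ∈ G, 1 ≤ ∑ i, a i * (g i : ℝ) := by
  obtain ⟨a, u, ha, hax, hau⟩ :=
    exists_separating_of_notMem_upperHull (hfin.image _) (hG.image _) hx
  have hu : 0 < u := lt_of_le_of_lt (Finset.sum_nonneg fun i _ => mul_nonneg (ha i) (hx0 i)) hax
  have hau0 : ∀ i, 0 ≤ a i / u := fun i => div_nonneg (ha i) hu.le
  have hnn : ∀ i, 0 ≤ min (a i / u) 1 := fun i => le_min (hau0 i) zero_le_one
  have hdiv : ∀ y : Fin r → ℝ, ∑ i, a i / u * y i = (∑ i, a i * y i) / u := by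
    intro y
    rw [Finset.sum_div]
    exact Finset.sum_congr rfl fun i _ => by ring
  refine ⟨fun i => min (a i / u) 1, hnn, fun i => min_le_right _ _, ?_, fun g hg => ?_⟩
  · refine lt_of_le_of_lt (Finset.sum_le_sum fun i _ =>
      mul_le_mul_of_nonneg_right (min_le_left _ _) (hx0 i)) ?_
    rw [hdiv, div_lt_one hu]
    exact hax
  -- Truncation at `1` is harmless because `g` is integral: a truncated coordinate with `g i ≠ 0`
  -- already contributes at least `1`.
  · by_cases h : ∃ i, 1 ≤ a i / u ∧ g i ≠ 0
    · obtain ⟨i, hi, hgi⟩ := h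
      refine le_trans ?_ (Finset.single_le_sum (f := fun i => min (a i / u) 1 * (g i : ℝ))
        (fun j _ => mul_nonneg (hnn j) (Nat.cast_nonneg _)) (Finset.mem_univ i))
      simp only [min_eq_right hi, one_mul]
      exact_mod_cast Nat.one_le_iff_ne_zero.2 hgi
    · push Not at h
      have : ∑ i, min (a i / u) 1 * (g i : ℝ) = ∑ i, a i / u * (g i : ℝ) := by
        refine Finset.sum_congr rfl fun i _ => ?_
        rcases le_total 1 (a i / u) with h1 | h1
        · simp [h i h1]
        · rw [min_eq_left h1]
      rw [this, hdiv, le_div_iff₀ hu, one_mul]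
      exact hau _ ⟨g, hg, rfl⟩

variable {ι : Type*} {G : ι → Set (Fin r →₀ ℕ)}

lemma isClosed_iInter_upperHull (hfin : ∀ j, (G j).Finite) :
    IsClosed (⋂ j, upperHull (realExp '' G j)) :=
  isClosed_iInter fun j => isClosed_upperHull ((hfin j).image _)

lemma iInter_upperHull_nonneg [Nonempty ι] :
    (⋂ j, upperHull (realExp '' G j)) ⊆ Set.Ici 0 :=
  (Set.iInter_subset _ (Classical.arbitrary ι)).trans (upperHull_nonneg (realExp_image_nonneg _))

lemma finite_extremePoints [Finite ι] (hfin : ∀ j, (G j).Finite) :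
    ((⋂ j, upperHull (realExp '' G j)).extremePoints ℝ).Finite := by
  have := finite_extremePoints_iInter_upperHull fun j => ((hfin j).image realExp).toFinset
  simpa using this

lemma iInter_upperHull_nonempty [Finite ι] (hG : ∀ j, (G j).Nonempty) :
    (⋂ j, upperHull (realExp '' G j)).Nonempty := by
  have := Fintype.ofFinite ι
  choose g hg using hG
  refine ⟨realExp (∑ j, g j), Set.mem_iInter.2 fun j => ?_⟩
  refine upperHull_mono_right (subset_upperHull _ ⟨g j, hg j, rfl⟩) fun i => ?_
  exact Nat.cast_le.2 (Finset.single_le_sum (f := g) (fun _ _ => zero_le) (Finset.mem_univ j) i)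

lemma extremePoints_nonempty [Nonempty ι] [Finite ι] (hfin : ∀ j, (G j).Finite)
    (hG : ∀ j, (G j).Nonempty) :
    ((⋂ j, upperHull (realExp '' G j)).extremePoints ℝ).Nonempty := by
  obtain ⟨x, hx⟩ := iInter_upperHull_nonempty hG
  obtain ⟨v, hv, -⟩ := exists_mem_extremePoints_sum_le (isClosed_iInter_upperHull hfin)
    iInter_upperHull_nonneg (a := 1) (by simp) hx
  exact ⟨v, hv⟩

theorem sum_le_of_minimal [Nonempty ι] [Finite ι] (hr : 0 < r) (hfin : ∀ j, (G j).Finite)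
    (hG : ∀ j, (G j).Nonempty) {d : ℕ}
    (hF : ∀ j i, (∃ m ≤ d, Finsupp.single i m ∈ G j) ∨ ∀ g ∈ G j, g i = 0) {δ : ℝ}
    (hδ : ∀ v ∈ (⋂ j, upperHull (realExp '' G j)).extremePoints ℝ, ∑ i, v i ≤ δ) {n : ℕ}
    (hn : 1 ≤ n) {α : Fin r →₀ ℕ} (hα : Minimal (· ∈ ⋂ j, upperPow (G j) n) α) :
    ∑ i, (α i : ℝ) ≤ δ * n + r + r * (r - 1) * d := by
  have hn0 : (0 : ℝ) < n := by exact_mod_cast hn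
  have hr1 : (1 : ℝ) ≤ r := by exact_mod_cast hr
  have hx : (n : ℝ)⁻¹ • realExp α ∈ ⋂ j, upperHull (realExp '' G j) := by
    refine Set.mem_iInter.2 fun j => ?_
    obtain ⟨y, hy, hyα⟩ := exists_mem_convexHull_smul_le (hG j) (Set.mem_iInter.1 hα.prop j)
    exact ⟨y, hy, by rwa [le_inv_smul_iff_of_pos hn0]⟩
  obtain ⟨z, hz, hzx⟩ := subset_upperHull_extremePoints (isClosed_iInter_upperHull hfin)
    iInter_upperHull_nonneg (finite_extremePoints hfin) hx
  have hzδ : ∑ i, z i ≤ δ := sum_le_of_mem_convexHull hδ hz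
  have hconv : Convex ℝ (⋂ j, upperHull (realExp '' G j)) :=
    convex_iInter fun j => convex_upperHull _
  have hzS : z ∈ ⋂ j, upperHull (realExp '' G j) := convexHull_min extremePoints_subset hconv hz
  have hz0 : ∀ i, 0 ≤ z i := iInter_upperHull_nonneg hzS
  rw [le_inv_smul_iff_of_pos hn0] at hzx
  have key : ∀ i, (α i : ℝ) ≤ n * z i + (1 + (r - 1) * d) := by
    intro i
    by_contra! hlt
    have hd0 : 0 ≤ ((r : ℝ) - 1) * d := mul_nonneg (by linarith) (Nat.cast_nonneg _)
    have hnz := mul_nonneg hn0.le (hz0 i)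
    have hαi : 1 ≤ α i := by
      have : (0 : ℝ) < α i := by linarith
      exact_mod_cast this
    set β : Fin r →₀ ℕ := α - Finsupp.single i 1 with hβ
    have hβi : β i + 1 = α i := by
      simp [hβ]; omega
    have hβl : ∀ l, l ≠ i → β l = α l := by
      intro l hl
      simp [hβ, Finsupp.single_eq_of_ne hl]
    have hmem : β ∈ ⋂ j, upperPow (G j) n := by
      refine Set.mem_iInter.2 fun j => ?_
      rcases hF j i with ⟨m, hmd, hm⟩ | h0
      · obtain ⟨y, hy, hyz⟩ := Set.mem_iInter.1 hzS j
        have hy0 : ∀ l, 0 ≤ y l := fun l =>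
          convexHull_min (realExp_image_nonneg _) (convex_Ici 0) hy l
        -- The `r - 1` extra copies required by rounding are all taken to be the pure power of
        -- `x_i`, so only coordinate `i` pays for them.
        have hmem : (n : ℝ) • y + ((r : ℝ) - 1) • realExp (Finsupp.single i m) ∈
            ((n : ℝ) + (r - 1)) • convexHull ℝ (realExp '' G j) := by
          rw [(convex_convexHull ℝ _).add_smul hn0.le (by linarith)]
          exact Set.add_mem_add (Set.smul_mem_smul_set hy)
            (Set.smul_mem_smul_set (subset_convexHull ℝ _ ⟨_, hm, rfl⟩))
        obtain ⟨x, hxc, hxe⟩ := hmem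
        refine mem_upperPow_of_smul_le hr (x := x) ⟨x, hxc, le_rfl⟩ fun l => ?_
        have hxl := congrFun hxe l
        simp only [Pi.smul_apply, Pi.add_apply, smul_eq_mul] at hxl ⊢
        rw [hxl]
        have hyl := mul_le_mul_of_nonneg_left (hyz l) hn0.le
        have hmd' : ((r : ℝ) - 1) * m ≤ (r - 1) * d :=
          mul_le_mul_of_nonneg_left (Nat.cast_le.2 hmd) (by linarith)
        by_cases hl : l = i
        · subst hl
          have h1 : (β l : ℝ) + 1 = α l := by exact_mod_cast hβi
          simp only [realExp, Finsupp.single_eq_same]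
          linarith
        · have h1 := hzx l
          simp only [Pi.smul_apply, smul_eq_mul, realExp] at h1
          simp only [realExp, Finsupp.single_eq_of_ne hl, hβl l hl]
          simp
          linarith
      · obtain ⟨γ, hγ, hγα⟩ := Set.mem_iInter.1 hα.prop j
        refine ⟨γ, hγ, fun l => ?_⟩
        by_cases hl : l = i
        · subst hl
          obtain ⟨y, hy, hyγ⟩ := realExp_mem_smul_convexHull (hG j) hγ
          have hyl : y l ≤ 0 := le_of_mem_convexHull (by
            rintro _ ⟨g, hg, rfl⟩
            simp [realExp, h0 g hg]) hy
          have h1 : (n : ℝ) * y l = γ l := congrFun hyγ l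
          have h2 : (γ l : ℝ) ≤ 0 := by
            rw [← h1]
            exact mul_nonpos_of_nonneg_of_nonpos hn0.le hyl
          have h3 : γ l ≤ 0 := by exact_mod_cast h2
          omega
        · rw [hβl l hl]
          exact hγα l
    have := hα.le_of_le hmem tsub_le_self i
    omega
  calc ∑ i, (α i : ℝ) ≤ ∑ i, (n * z i + (1 + (r - 1) * d)) := Finset.sum_le_sum fun i _ => key i
    _ = n * ∑ i, z i + r * (1 + (r - 1) * d) := by
      rw [Finset.sum_add_distrib, ← Finset.mul_sum]
      simp only [Finset.sum_const, Finset.card_univ, Fintype.card_fin, nsmul_eq_mul]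
    _ ≤ n * δ + r * (1 + (r - 1) * d) := by
      gcongr
    _ = δ * n + r + r * (r - 1) * d := by ring

/-- Above height `d`, coordinate `i` can move both down to `d` and equally far up within the
intersection, so `v` would be a midpoint. -/
lemma extremePoints_le [Nonempty ι] {d : ℕ} (hd : ∀ j, ∀ g ∈ G j, ∀ i, g i ≤ d) {v : Fin r → ℝ}
    (hv : v ∈ (⋂ j, upperHull (realExp '' G j)).extremePoints ℝ) (i : Fin r) : v i ≤ d := by
  by_contra! hlt
  have h1 : Function.update v i d ∈ ⋂ j, upperHull (realExp '' G j) := by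
    refine Set.mem_iInter.2 fun j => ?_
    obtain ⟨y, hy, hyv⟩ := Set.mem_iInter.1 hv.1 j
    refine ⟨y, hy, fun l => ?_⟩
    by_cases hl : l = i
    · subst hl
      rw [Function.update_self]
      refine le_of_mem_convexHull ?_ hy
      rintro _ ⟨g, hg, rfl⟩
      exact Nat.cast_le.2 (hd j g hg l)
    · rw [Function.update_of_ne hl]
      exact hyv l
  have h2 : v + (v - Function.update v i d) ∈ ⋂ j, upperHull (realExp '' G j) := by
    refine Set.mem_iInter.2 fun j => upperHull_mono_right (Set.mem_iInter.1 hv.1 j) ?_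
    refine le_add_of_nonneg_right (sub_nonneg.2 ?_)
    exact update_le_iff.2 ⟨hlt.le, fun _ _ => le_rfl⟩
  have := (mem_extremePoints.1 hv).2 _ h1 _ h2 ⟨1 / 2, 1 / 2, by norm_num, by norm_num, by norm_num,
    by ext l; simp; ring⟩
  have := congrFun this.1 i
  rw [Function.update_self] at this
  exact hlt.ne this

theorem exists_minimal_le_sum [Nonempty ι] (hr : 0 < r) (hfin : ∀ j, (G j).Finite)
    (hG : ∀ j, (G j).Nonempty) {d : ℕ} (hd : ∀ j, ∀ g ∈ G j, ∀ i, g i ≤ d)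
    (hF : ∀ j i, (∃ m ≤ d, Finsupp.single i m ∈ G j) ∨ ∀ g ∈ G j, g i = 0) {v : Fin r → ℝ}
    (hv : v ∈ (⋂ j, upperHull (realExp '' G j)).extremePoints ℝ) (n : ℕ) :
    ∃ β, Minimal (· ∈ ⋂ j, upperPow (G j) n) β ∧
      (∑ i, v i) * n - r * (1 + (r - 1) * d) ^ 2 ≤ ∑ i, (β i : ℝ) := by
  have hr1 : (1 : ℝ) ≤ r := by exact_mod_cast hr
  have hn0 : (0 : ℝ) ≤ n := n.cast_nonneg
  have hv0 : ∀ i, 0 ≤ v i := iInter_upperHull_nonneg hv.1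
  have hvd := extremePoints_le hd hv
  set K : ℝ := 1 + (r - 1) * d with hK
  have hK0 : 0 ≤ K := by
    have : (0 : ℝ) ≤ (r - 1) * d := mul_nonneg (by linarith) (Nat.cast_nonneg _)
    linarith
  let α : Fin r →₀ ℕ := Finsupp.equivFunOnFinite.symm fun i => ⌈((n : ℝ) + (r - 1)) * v i⌉₊
  have hαi : ∀ i, α i = ⌈((n : ℝ) + (r - 1)) * v i⌉₊ := fun i => rfl
  have hαlow : ((n : ℝ) + (r - 1)) • v ≤ realExp α := fun i => Nat.le_ceil _
  have hαmem : α ∈ ⋂ j, upperPow (G j) n :=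
    Set.mem_iInter.2 fun j => mem_upperPow_of_smul_le hr (Set.mem_iInter.1 hv.1 j) hαlow
  have hαup : ∀ i, (α i : ℝ) ≤ n * v i + K := by
    intro i
    have h1 := Nat.ceil_lt_add_one (mul_nonneg (by linarith : (0 : ℝ) ≤ n + (r - 1)) (hv0 i))
    have h2 := mul_le_mul_of_nonneg_left (hvd i) (by linarith : (0 : ℝ) ≤ (r : ℝ) - 1)
    rw [hαi]
    linarith
  obtain ⟨β, hβα, hβ⟩ := exists_minimal_le_of_wellFoundedLT (· ∈ ⋂ j, upperPow (G j) n) α hαmem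
  refine ⟨β, hβ, ?_⟩
  have hβα' : ∀ i, (β i : ℝ) ≤ α i := fun i => Nat.cast_le.2 (hβα i)
  have key : ∀ i, (α i : ℝ) - β i ≤ K * K := by
    intro i
    rcases (hv0 i).eq_or_lt with hvi | hvi
    · have h0 : α i = 0 := by rw [hαi, ← hvi]; simp
      rw [h0]
      have := (β i).cast_nonneg (α := ℝ)
      push_cast
      nlinarith
    -- Working with `v - ε e_i` and letting `ε → 0` avoids describing the facets through `v`.
    have bound : ∀ ε : ℝ, 0 < ε → ε < v i → (α i : ℝ) - β i ≤ K * K + d * n * ε := by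
      intro ε hε hεv
      have hnot : v - ε • Pi.single i 1 ∉ ⋂ j, upperHull (realExp '' G j) := by
        intro hmem
        have h2 : v + ε • Pi.single i 1 ∈ ⋂ j, upperHull (realExp '' G j) :=
          Set.mem_iInter.2 fun j => upperHull_mono_right (Set.mem_iInter.1 hv.1 j)
            (le_add_of_nonneg_right (smul_nonneg hε.le (Pi.single_nonneg.2 zero_le_one)))
        have := (mem_extremePoints.1 hv).2 _ hmem _ h2 ⟨1 / 2, 1 / 2, by norm_num, by norm_num,
          by norm_num, by ext l; simp; ring⟩
        have := congrFun this.2 i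
        simp at this
        linarith
      rw [Set.mem_iInter] at hnot
      push Not at hnot
      obtain ⟨j, hj⟩ := hnot
      have hsub : ∀ l, (v - ε • Pi.single i 1 : Fin r → ℝ) l = v l - if l = i then ε else 0 := by
        intro l
        simp [Pi.single_apply]
      have hx0 : (0 : Fin r → ℝ) ≤ v - ε • Pi.single i 1 := by
        intro l
        rw [hsub]
        split_ifs with h
        · subst h; simpa using hεv.le
        · simpa using hv0 l
      -- If `x_i` did not occur in `G j`, lowering coordinate `i` could not leave the `j`-th
      -- polyhedron.
      obtain ⟨m, hmd, hm⟩ : ∃ m ≤ d, Finsupp.single i m ∈ G j := by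
        refine (hF j i).resolve_right fun h0 => hj ?_
        obtain ⟨y, hy, hyv⟩ := Set.mem_iInter.1 hv.1 j
        refine ⟨y, hy, fun l => ?_⟩
        by_cases hl : l = i
        · subst hl
          refine le_trans (le_of_mem_convexHull ?_ hy) (hx0 l)
          rintro _ ⟨g, hg, rfl⟩
          simp [realExp, h0 g hg]
        · rw [hsub, if_neg hl, sub_zero]
          exact hyv l
      obtain ⟨a, ha0, ha1, hax, hag⟩ := exists_truncated_separating (hfin j) (hG j) hx0 hj
      have ham : 1 ≤ a i * d := by
        have := hag _ hm
        rw [Finset.sum_eq_single i (fun l _ hl => by simp [Finsupp.single_eq_of_ne hl])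
          (by simp)] at this
        rw [Finsupp.single_eq_same] at this
        exact this.trans (mul_le_mul_of_nonneg_left (Nat.cast_le.2 hmd) (ha0 i))
      have hav : ∑ l, a l * v l ≤ 1 + ε := by
        simp only [hsub, mul_sub, Finset.sum_sub_distrib] at hax
        simp only [mul_ite, mul_zero, Finset.sum_ite_eq', Finset.mem_univ, if_true] at hax
        nlinarith [ha1 i]
      have haβ : (n : ℝ) ≤ ∑ l, a l * (β l : ℝ) := by
        obtain ⟨y, hy, hyβ⟩ :=
          exists_mem_convexHull_smul_le (hG j) (Set.mem_iInter.1 hβ.prop j)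
        have h1 : (1 : ℝ) ≤ ∑ l, a l * y l := le_sum_of_mem_convexHull (by
          rintro _ ⟨g, hg, rfl⟩
          exact hag g hg) hy
        calc (n : ℝ) ≤ n * ∑ l, a l * y l := le_mul_of_one_le_right hn0 h1
          _ = ∑ l, a l * (n * y l) := by
            rw [Finset.mul_sum]
            exact Finset.sum_congr rfl fun l _ => by ring
          _ ≤ _ := Finset.sum_le_sum fun l _ => mul_le_mul_of_nonneg_left (hyβ l) (ha0 l)
      have hsum : ∑ l, a l ≤ a i + (r - 1) := by
        rw [← Finset.add_sum_erase _ _ (Finset.mem_univ i)]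
        have h1 : ∑ l ∈ Finset.univ.erase i, a l ≤ ∑ l ∈ Finset.univ.erase i, (1 : ℝ) :=
          Finset.sum_le_sum fun l _ => ha1 l
        rw [Finset.sum_const, Finset.card_erase_of_mem (Finset.mem_univ i), Finset.card_univ,
          Fintype.card_fin, nsmul_eq_mul, mul_one, Nat.cast_sub hr, Nat.cast_one] at h1
        linarith
      -- Compare `a · α ≤ n (1 + ε) + K ∑ a` with `a · β ≥ n`; all terms of `a · (α - β)` are
      -- nonnegative. Dividing by `a i` then uses `a i * d ≥ 1`.
      have hmain : a i * ((α i : ℝ) - β i) ≤ n * ε + K * (a i + (r - 1)) := by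
        have h1 : a i * ((α i : ℝ) - β i) ≤ ∑ l, a l * ((α l : ℝ) - β l) :=
          Finset.single_le_sum (f := fun l => a l * ((α l : ℝ) - β l))
            (fun l _ => mul_nonneg (ha0 l) (sub_nonneg.2 (hβα' l))) (Finset.mem_univ i)
        have h2 : ∑ l, a l * (α l : ℝ) ≤ n * (∑ l, a l * v l) + K * ∑ l, a l := by
          rw [Finset.mul_sum, Finset.mul_sum, ← Finset.sum_add_distrib]
          refine Finset.sum_le_sum fun l _ => ?_
          have := mul_le_mul_of_nonneg_left (hαup l) (ha0 l)
          linarith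
        simp only [mul_sub, Finset.sum_sub_distrib] at h1
        have h3 := mul_le_mul_of_nonneg_left hav hn0
        have h4 := mul_le_mul_of_nonneg_left hsum hK0
        linarith
      have haipos : 0 < a i := by
        by_contra! h
        have := le_antisymm h (ha0 i)
        rw [this] at ham
        norm_num at ham
      refine le_of_mul_le_mul_left (hmain.trans ?_) haipos
      have h5 : 0 ≤ n * ε := by positivity
      have h6 : 0 ≤ K * ((r : ℝ) - 1) := mul_nonneg hK0 (by linarith)
      have h7 := mul_le_mul_of_nonneg_left ham h5
      have h8 := mul_le_mul_of_nonneg_left ham h6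
      have h9 : a i * (K * K + d * n * ε) =
          K * a i + K * (r - 1) * (a i * d) + n * ε * (a i * d) := by
        rw [hK]; ring
      rw [h9]
      linarith
    have hlim : Tendsto (fun ε : ℝ => K * K + d * n * ε) (𝓝[>] 0) (𝓝 (K * K + d * n * 0)) :=
      (Continuous.tendsto (by fun_prop) 0).mono_left nhdsWithin_le_nhds
    rw [mul_zero, add_zero] at hlim
    refine ge_of_tendsto hlim ?_
    filter_upwards [Ioo_mem_nhdsGT hvi] with ε hε
    exact bound ε hε.1 hε.2
  have hsum : ∑ i, (n * v i - K * K) ≤ ∑ i, (β i : ℝ) := by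
    refine Finset.sum_le_sum fun i _ => ?_
    have h1 := key i
    have h2 : ((n : ℝ) + (r - 1)) * v i ≤ α i := hαlow i
    have h3 : 0 ≤ ((r : ℝ) - 1) * v i := mul_nonneg (by linarith) (hv0 i)
    linarith
  rw [Finset.sum_sub_distrib, ← Finset.mul_sum] at hsum
  simp only [Finset.sum_const, Finset.card_univ, Fintype.card_fin, nsmul_eq_mul] at hsum
  linarith [sq K, mul_comm (n : ℝ) (∑ i, v i)]

end Exponents

/-! ### Primary components at minimal primes as contractions -/

section Contraction

variable {R : Type*} [CommRing R]

/-- The contraction `J R_p ∩ R`. -/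
noncomputable def contraction (p : Ideal R) [p.IsPrime] (J : Ideal R) : Ideal R :=
  (J.map (algebraMap R (Localization.AtPrime p))).comap (algebraMap R (Localization.AtPrime p))

lemma mem_contraction {p : Ideal R} [p.IsPrime] {J : Ideal R} {x : R} :
    x ∈ contraction p J ↔ ∃ s ∉ p, s * x ∈ J := by
  rw [contraction, Ideal.mem_comap,
    IsLocalization.algebraMap_mem_map_algebraMap_iff p.primeCompl]
  rfl

lemma eq_contraction_of_isMinimalPrimaryDecomposition {I Q : Ideal R} {t : Finset (Ideal R)}
    (ht : Submodule.IsMinimalPrimaryDecomposition I t) (hQ : Q ∈ t) [Q.radical.IsPrime]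
    (hmin : Q.radical ∈ I.minimalPrimes) : Q = contraction Q.radical I := by
  classical
  have hprod : I = Q ⊓ (t.erase Q).inf id := by
    rw [← ht.inf_eq, ← Finset.insert_erase hQ, Finset.inf_insert, Finset.erase_insert (by simp)]
    rfl
  ext x
  rw [mem_contraction]
  constructor
  · intro hx
    -- Otherwise another component lies in the prime `Q.radical`; minimality makes the two radicals
    -- equal, contrary to the decomposition being minimal. An element of the other components
    -- outside `Q.radical` then multiplies `Q` into `I`.
    have hnot : ¬ (t.erase Q).inf id ≤ Q.radical := by
      intro hle
      obtain ⟨q, hq, hqQ⟩ := (Ideal.IsPrime.inf_le' inferInstance).1 hle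
      rw [Finset.mem_erase] at hq
      have hIq : I ≤ q := ht.inf_eq.symm.trans_le (Finset.inf_le hq.2)
      have hrad : q.radical ≤ Q.radical := Ideal.IsPrime.radical_le_iff inferInstance |>.2 hqQ
      refine ht.distinct hq.2 hQ hq.1 ?_
      simp only [Submodule.colon_univ]
      exact le_antisymm hrad (hmin.2
        ⟨Ideal.isPrime_radical (ht.primary hq.2), hIq.trans Ideal.le_radical⟩ hrad)
    obtain ⟨s, hs, hsQ⟩ := SetLike.not_le_iff_exists.1 hnot
    refine ⟨s, hsQ, ?_⟩
    rw [hprod]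
    exact ⟨Ideal.mul_mem_left _ _ hx, Ideal.mul_mem_right _ _ hs⟩
  · rintro ⟨s, hs, hsx⟩
    have hsQ : x * s ∈ Q := by
      rw [mul_comm]
      exact (hprod.trans_le inf_le_left) hsx
    exact ((Ideal.isPrimary_iff.1 (ht.primary hQ)).2 hsQ).resolve_right hs

lemma minimalPrimaryComponents_eq [IsNoetherianRing R] (I : Ideal R) :
    minimalPrimaryComponents I =
      Set.range fun p : I.minimalPrimes => @contraction R _ (p : Ideal R) p.2.1.1 I := by
  ext Q
  constructor
  · rintro ⟨t, ht, hQ, hmin⟩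
    have : Q.radical.IsPrime := hmin.1.1
    exact ⟨⟨Q.radical, hmin⟩, (eq_contraction_of_isMinimalPrimaryDecomposition ht hQ hmin).symm⟩
  · rintro ⟨⟨p, hp⟩, rfl⟩
    obtain ⟨t, ht⟩ := Submodule.IsLasker.exists_isMinimalPrimaryDecomposition
      (Submodule.isLasker R R) I
    obtain ⟨Q, hQ, rfl⟩ := Ideal.IsMinimalPrimaryDecomposition.minimalPrimes_subset_image_radical
      ht hp
    have : Q.radical.IsPrime := hp.1.1
    have heq := eq_contraction_of_isMinimalPrimaryDecomposition ht hQ hp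
    refine ⟨t, ht, ?_⟩
    dsimp only
    rw [← heq]
    exact ⟨hQ, hp⟩

end Contraction

/-! ### Monomial ideals: generators, minimal primes, localization, Newton polyhedra -/

section MonomialIdeals

open MvPolynomial

variable (k : Type*) [Field k] {r : ℕ}

/-- The ideal generated by the monomials with exponents in `S`. -/
noncomputable def spanMonomials (S : Set (Fin r →₀ ℕ)) : Ideal (MvPolynomial (Fin r) k) :=
  Ideal.span ((fun α => monomial α (1 : k)) '' S)

variable {k}

lemma mem_spanMonomials {S : Set (Fin r →₀ ℕ)} {f : MvPolynomial (Fin r) k} :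
    f ∈ spanMonomials k S ↔ ∀ α ∈ f.support, ∃ s ∈ S, s ≤ α :=
  mem_ideal_span_monomial_image

lemma monomial_mem_spanMonomials {S : Set (Fin r →₀ ℕ)} {α : Fin r →₀ ℕ} :
    monomial α (1 : k) ∈ spanMonomials k S ↔ ∃ s ∈ S, s ≤ α := by
  classical
  rw [mem_spanMonomials, support_monomial, if_neg one_ne_zero]
  simp

lemma spanMonomials_congr {S T : Set (Fin r →₀ ℕ)}
    (h : ∀ α, (∃ s ∈ S, s ≤ α) ↔ ∃ s ∈ T, s ≤ α) : spanMonomials k S = spanMonomials k T := by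
  ext f
  simp only [mem_spanMonomials, h]

lemma spanMonomials_mul (S T : Set (Fin r →₀ ℕ)) :
    spanMonomials k S * spanMonomials k T = spanMonomials k (S + T) := by
  rw [spanMonomials, spanMonomials, spanMonomials, Ideal.span_mul_span']
  congr 1
  rw [← Set.image2_mul, ← Set.image2_add, Set.image2_image_left, Set.image2_image_right,
    Set.image_image2]
  simp [monomial_mul]

lemma spanMonomials_pow (S : Set (Fin r →₀ ℕ)) (n : ℕ) :
    spanMonomials k S ^ n = spanMonomials k (n • S) := by
  induction n with
  | zero =>
    rw [pow_zero, zero_nsmul, Ideal.one_eq_top, Eq.comm, Ideal.eq_top_iff_one]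
    exact mem_spanMonomials.2 fun α _ => ⟨0, rfl, zero_le⟩
  | succ n ih => rw [pow_succ, ih, spanMonomials_mul, succ_nsmul]

lemma idealOfVars_eq_spanMonomials : idealOfVars (Fin r) k =
    spanMonomials k (Set.range fun i => Finsupp.single i 1) := by
  rw [spanMonomials, ← Set.range_comp]
  rfl

lemma mem_idealOfVars_mul_spanMonomials {S : Set (Fin r →₀ ℕ)} {f : MvPolynomial (Fin r) k} :
    f ∈ idealOfVars (Fin r) k * spanMonomials k S ↔
      ∀ α ∈ f.support, ∃ i, ∃ s ∈ S, Finsupp.single i 1 + s ≤ α := by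
  rw [idealOfVars_eq_spanMonomials, spanMonomials_mul, mem_spanMonomials]
  simp [Set.mem_add]

lemma minGenDegrees_spanMonomials {U : Set (Fin r →₀ ℕ)} (hU : IsUpperSet U) :
    minGenDegrees (spanMonomials k U) = Finsupp.degree '' {β | Minimal (· ∈ U) β} := by
  classical
  ext j
  constructor
  · rintro ⟨f, hf, hhom, hnot⟩
    rw [mem_idealOfVars_mul_spanMonomials] at hnot
    push Not at hnot
    obtain ⟨β, hβ, hβmin⟩ := hnot
    obtain ⟨s, hs, hsβ⟩ := mem_spanMonomials.1 hf β hβ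
    refine ⟨β, ⟨hU hsβ hs, fun γ hγ hγβ => ?_⟩, ?_⟩
    · by_contra hle
      rw [Finsupp.le_def] at hle
      push Not at hle
      obtain ⟨i, hi⟩ := hle
      refine hβmin i γ hγ fun l => ?_
      by_cases hl : l = i
      · subst hl
        simp; omega
      · simpa [Finsupp.single_eq_of_ne hl] using hγβ l
    · by_contra hne
      exact mem_support_iff.1 hβ (hhom.coeff_eq_zero hne)
  · rintro ⟨β, hβ, rfl⟩
    refine ⟨monomial β 1, monomial_mem_spanMonomials.2 ⟨β, hβ.prop, le_rfl⟩,
      isHomogeneous_monomial _ rfl, fun hmem => ?_⟩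
    obtain ⟨i, s, hs, hsβ⟩ := mem_idealOfVars_mul_spanMonomials.1 hmem β (by
      rw [support_monomial, if_neg one_ne_zero]; simp)
    have h1 := hβ.le_of_le hs (le_add_self.trans hsβ) i
    have h2 := hsβ i
    simp at h2
    omega

/-- Dickson's lemma: the minimal exponents form an antichain, hence a finite set. -/
lemma isGreatest_maxGenDegree {U : Set (Fin r →₀ ℕ)} (hU : IsUpperSet U) (hne : U.Nonempty) :
    IsGreatest (minGenDegrees (spanMonomials k U)) (maxGenDegree (spanMonomials k U)) := by
  have hfin : {β | Minimal (· ∈ U) β}.Finite :=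
    WellQuasiOrderedLE.finite_of_isAntichain (setOfPred_minimal_antichain _)
  have hne' : {β | Minimal (· ∈ U) β}.Nonempty := by
    obtain ⟨α, hα⟩ := hne
    obtain ⟨β, -, hβ⟩ := exists_minimal_le_of_wellFoundedLT (· ∈ U) α hα
    exact ⟨β, hβ⟩
  have hdeg := minGenDegrees_spanMonomials (k := k) hU
  have hbdd : BddAbove (minGenDegrees (spanMonomials k U)) := by
    rw [hdeg]
    exact (hfin.image _).bddAbove
  refine ⟨Nat.sSup_mem ?_ hbdd, fun j hj => le_csSup hbdd hj⟩
  rw [hdeg]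
  exact hne'.image _

open Classical in
/-- Replace the coordinates outside `F` by `0`. -/
noncomputable def restrictTo (F : Set (Fin r)) : (Fin r →₀ ℕ) →+ (Fin r →₀ ℕ) :=
  Finsupp.filterAddHom (· ∈ F)

lemma restrictTo_apply_of_mem {F : Set (Fin r)} {i : Fin r} (hi : i ∈ F) (α : Fin r →₀ ℕ) :
    restrictTo F α i = α i := by
  classical
  exact Finsupp.filter_apply_pos _ _ hi

lemma restrictTo_apply_of_notMem {F : Set (Fin r)} {i : Fin r} (hi : i ∉ F) (α : Fin r →₀ ℕ) :
    restrictTo F α i = 0 := by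
  classical
  exact Finsupp.filter_apply_neg _ _ hi

lemma restrictTo_le (F : Set (Fin r)) (α : Fin r →₀ ℕ) : restrictTo F α ≤ α := by
  intro i
  by_cases hi : i ∈ F
  · rw [restrictTo_apply_of_mem hi]
  · rw [restrictTo_apply_of_notMem hi]; exact zero_le

lemma mk_aeval_eq_mk (F : Set (Fin r)) [DecidablePred (· ∈ F)]
    {p : Ideal (MvPolynomial (Fin r) k)} (hp : ∀ i ∈ F, (X i : MvPolynomial (Fin r) k) ∈ p)
    (f : MvPolynomial (Fin r) k) :
    Ideal.Quotient.mk p (aeval (fun i => if i ∈ F then 0 else X i) f) = Ideal.Quotient.mk p f := by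
  have : (Ideal.Quotient.mkₐ k p).comp (aeval fun i => if i ∈ F then 0 else X i) =
      Ideal.Quotient.mkₐ k p := by
    ext i
    by_cases hi : i ∈ F
    · simp [hi, (Ideal.Quotient.eq_zero_iff_mem.2 (hp i hi))]
    · simp [hi]
  exact congrArg (fun φ => φ f) this

lemma span_X_image_eq_ker (F : Set (Fin r)) [DecidablePred (· ∈ F)] :
    Ideal.span (X '' F : Set (MvPolynomial (Fin r) k)) =
      RingHom.ker (aeval (R := k) (fun i => if i ∈ F then 0 else (X i : MvPolynomial (Fin r) k))) := by
  refine le_antisymm (Ideal.span_le.2 ?_) fun f hf => ?_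
  · rintro _ ⟨i, hi, rfl⟩
    simp [RingHom.mem_ker, hi]
  · rw [← Ideal.Quotient.eq_zero_iff_mem,
      ← mk_aeval_eq_mk F (fun i hi => Ideal.subset_span (Set.mem_image_of_mem X hi)),
      RingHom.mem_ker.1 hf, map_zero]

instance isPrime_span_X_image (F : Set (Fin r)) :
    (Ideal.span (X '' F : Set (MvPolynomial (Fin r) k))).IsPrime := by
  classical
  rw [span_X_image_eq_ker]
  exact RingHom.ker_isPrime _

lemma spanMonomials_le_span_X_image {S : Set (Fin r →₀ ℕ)} {F : Set (Fin r)} :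
    spanMonomials k S ≤ Ideal.span (X '' F) ↔ ∀ s ∈ S, ∃ i ∈ F, s i ≠ 0 := by
  classical
  rw [spanMonomials, Ideal.span_le, Set.image_subset_iff]
  refine forall₂_congr fun s _ => ?_
  change monomial s (1 : k) ∈ Ideal.span (X '' F) ↔ _
  rw [mem_ideal_span_X_image, support_monomial, if_neg one_ne_zero]
  simp

lemma exists_X_mem_of_monomial_mem {p : Ideal (MvPolynomial (Fin r) k)} [hp : p.IsPrime]
    {s : Fin r →₀ ℕ} (h : monomial s (1 : k) ∈ p) :
    ∃ i, (X i : MvPolynomial (Fin r) k) ∈ p ∧ s i ≠ 0 := by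
  rw [monomial_eq, map_one, one_mul, Finsupp.prod, hp.prod_mem_iff] at h
  obtain ⟨i, hi, hmem⟩ := h
  exact ⟨i, hp.mem_of_pow_mem _ hmem, Finsupp.mem_support_iff.1 hi⟩

/-- The minimal primes of a monomial ideal are generated by minimal sets of variables that meet
every generator. -/
lemma exists_eq_span_X_image {S : Set (Fin r →₀ ℕ)} {p : Ideal (MvPolynomial (Fin r) k)}
    (hp : p ∈ (spanMonomials k S).minimalPrimes) :
    ∃ F : Set (Fin r), p = Ideal.span (X '' F) ∧
      ∀ i ∈ F, ∃ s ∈ S, ∀ l ∈ F, l ≠ i → s l = 0 := by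
  have hprime : p.IsPrime := hp.1.1
  set F : Set (Fin r) := {i | (X i : MvPolynomial (Fin r) k) ∈ p} with hF
  have hle : Ideal.span (X '' F) ≤ p := by
    rw [Ideal.span_le]
    rintro _ ⟨i, hi, rfl⟩
    exact hi
  have hI : spanMonomials k S ≤ Ideal.span (X '' F) := by
    rw [spanMonomials_le_span_X_image]
    intro s hs
    exact exists_X_mem_of_monomial_mem (hp.1.2 (monomial_mem_spanMonomials.2 ⟨s, hs, le_rfl⟩))
  refine ⟨F, le_antisymm (hp.2 ⟨inferInstance, hI⟩ hle) hle, fun i hi => ?_⟩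
  by_contra! hcon
  -- If every generator still met `F` without `i`, the smaller set of variables would give a smaller
  -- prime over the ideal.
  have hI' : spanMonomials k S ≤ Ideal.span (X '' (F \ {i})) := by
    rw [spanMonomials_le_span_X_image]
    intro s hs
    obtain ⟨l, hl, hli, hsl⟩ := hcon s hs
    exact ⟨l, ⟨hl, hli⟩, hsl⟩
  have hle' : Ideal.span (X '' (F \ {i})) ≤ p :=
    (Ideal.span_mono (Set.image_mono Set.sdiff_subset)).trans hle
  have hX : (X i : MvPolynomial (Fin r) k) ∈ Ideal.span (X '' (F \ {i})) :=
    hp.2 ⟨inferInstance, hI'⟩ hle' hi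
  rw [mem_ideal_span_X_image] at hX
  obtain ⟨l, hl, hl'⟩ := hX (Finsupp.single i 1) (by simp [support_X])
  exact hl' (Finsupp.single_eq_of_ne hl.2)

/-- A nonzero polynomial that is multiplied into a monomial ideal by a polynomial outside
`(X i, i ∈ F)` has a monomial that lies in the ideal after inverting the variables outside `F`. -/
lemma exists_mem_support_restrictTo_le {S : Set (Fin r →₀ ℕ)} {F : Set (Fin r)}
    {f t : MvPolynomial (Fin r) k} (hf : f ≠ 0) (ht : t ∉ Ideal.span (X '' F))
    (h : t * f ∈ spanMonomials k S) : ∃ b ∈ f.support, ∃ s ∈ S, restrictTo F s ≤ b := by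
  classical
  -- Grade by the degree in the variables of `F`. The weight-`0` part of `t` is nonzero, and its
  -- product with the lowest part of `f` is the weight-`e` part of `t * f`, so a monomial `c` of
  -- that product survives. Writing `c = a + b` with `a` free of `F`, a generator dividing `c`
  -- divides `b` on `F`.
  let w : Fin r → ℕ := fun i => if i ∈ F then 1 else 0
  obtain ⟨b₀, hb₀, hmin⟩ := f.support.exists_min_image (Finsupp.weight w) (support_nonempty.2 hf)
  set e := Finsupp.weight w b₀
  have hw : ∀ a : Fin r →₀ ℕ, Finsupp.weight w a = 0 → ∀ i ∈ F, a i = 0 := by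
    intro a ha i hi
    by_contra hne
    have := Finsupp.le_weight w (s := i) (by simp [w, hi]) a
    omega
  have ht0 : weightedHomogeneousComponent w 0 t ≠ 0 := by
    rw [mem_ideal_span_X_image] at ht
    push Not at ht
    obtain ⟨a, ha, ha0⟩ := ht
    refine ne_zero_iff.2 ⟨a, ?_⟩
    rw [coeff_weightedHomogeneousComponent, if_pos]
    · exact mem_support_iff.1 ha
    · rw [Finsupp.weight_apply, Finsupp.sum]
      refine Finset.sum_eq_zero fun i _ => ?_
      by_cases hi : i ∈ F
      · simp [ha0 i hi]
      · simp [w, hi]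
  have hf0 : weightedHomogeneousComponent w e f ≠ 0 := by
    refine ne_zero_iff.2 ⟨b₀, ?_⟩
    rw [coeff_weightedHomogeneousComponent, if_pos rfl]
    exact mem_support_iff.1 hb₀
  obtain ⟨c, hc⟩ := ne_zero_iff.1 (mul_ne_zero ht0 hf0)
  have hterm : ∀ x ∈ Finset.HasAntidiagonal.antidiagonal c,
      coeff x.1 (weightedHomogeneousComponent w 0 t) * coeff x.2 (weightedHomogeneousComponent w e f)
        ≠ 0 → Finsupp.weight w x.1 = 0 ∧ Finsupp.weight w x.2 = e ∧ x.2 ∈ f.support := by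
    intro x _ hx
    simp only [coeff_weightedHomogeneousComponent] at hx
    by_cases h1 : Finsupp.weight w x.1 = 0
    · by_cases h2 : Finsupp.weight w x.2 = e
      · exact ⟨h1, h2, mem_support_iff.2 fun h3 => hx (by simp [h3])⟩
      · simp [h2] at hx
    · simp [h1] at hx
  rw [coeff_mul] at hc
  obtain ⟨⟨a, b⟩, hab, hne⟩ := Finset.exists_ne_zero_of_sum_ne_zero hc
  obtain ⟨ha, hb, hbf⟩ := hterm _ hab hne
  rw [Finset.HasAntidiagonal.mem_antidiagonal] at hab
  have hcw : Finsupp.weight w c = e := by rw [← hab, map_add, ha, hb, zero_add]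
  have hcsupp : c ∈ (t * f).support := by
    rw [mem_support_iff, coeff_mul]
    convert! hc using 1
    refine Finset.sum_congr rfl fun x hx => ?_
    have hx' := Finset.HasAntidiagonal.mem_antidiagonal.1 hx
    have hxw : Finsupp.weight w x.1 + Finsupp.weight w x.2 = e := by
      rw [← map_add, hx', hcw]
    simp only [coeff_weightedHomogeneousComponent]
    by_cases h1 : Finsupp.weight w x.1 = 0
    · rw [if_pos h1, if_pos (by omega)]
    · have : coeff x.2 f = 0 := by
        by_contra h2
        have := hmin x.2 (mem_support_iff.2 h2)
        omega
      simp [this]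
  obtain ⟨s, hs, hsc⟩ := mem_spanMonomials.1 h c hcsupp
  refine ⟨b, hbf, s, hs, fun i => ?_⟩
  by_cases hi : i ∈ F
  · rw [restrictTo_apply_of_mem hi]
    have h1 := hsc i
    rw [← hab, Finsupp.add_apply, hw a ha i hi, zero_add] at h1
    exact h1
  · rw [restrictTo_apply_of_notMem hi]
    exact zero_le

lemma contraction_spanMonomials (S : Set (Fin r →₀ ℕ)) (F : Set (Fin r)) :
    contraction (Ideal.span (X '' F)) (spanMonomials k S) =
      spanMonomials k (restrictTo F '' S) := by
  classical
  have hge : spanMonomials k (restrictTo F '' S) ≤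
      contraction (Ideal.span (X '' F)) (spanMonomials k S) := by
    rw [spanMonomials, Ideal.span_le]
    rintro _ ⟨_, ⟨s, hs, rfl⟩, rfl⟩
    refine mem_contraction.2 ⟨monomial (s - restrictTo F s) 1, ?_, ?_⟩
    · rw [mem_ideal_span_X_image, support_monomial, if_neg one_ne_zero]
      push Not
      refine ⟨_, Finset.mem_singleton_self _, fun i hi => ?_⟩
      rw [Finsupp.tsub_apply, restrictTo_apply_of_mem hi, Nat.sub_self]
    · rw [monomial_mul, one_mul, tsub_add_cancel_of_le (restrictTo_le F s)]
      exact monomial_mem_spanMonomials.2 ⟨s, hs, le_rfl⟩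
  refine le_antisymm (fun f hf => ?_) hge
  let good : (Fin r →₀ ℕ) → Prop := fun α => ∃ s ∈ restrictTo F '' S, s ≤ α
  -- Removing the terms already in the target leaves `g` in the contraction; if `g ≠ 0`, one of its
  -- monomials would be good after all.
  let g : MvPolynomial (Fin r) k := ∑ α ∈ f.support with ¬ good α, monomial α (coeff α f)
  have hg : ∀ α, coeff α g = if good α then 0 else coeff α f := by
    intro α
    simp only [g, coeff_sum, coeff_monomial, Finset.sum_ite_eq', Finset.mem_filter, mem_support_iff]
    by_cases h1 : good α <;> by_cases h2 : coeff α f = 0 <;> simp [h1, h2]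
  have hfg : f - g ∈ spanMonomials k (restrictTo F '' S) := by
    refine mem_spanMonomials.2 fun α hα => ?_
    by_contra hbad
    rw [mem_support_iff, coeff_sub, hg, if_neg hbad, sub_self] at hα
    exact hα rfl
  have hgc : g ∈ contraction (Ideal.span (X '' F)) (spanMonomials k S) := by
    have := sub_mem hf (hge hfg)
    rwa [sub_sub_cancel] at this
  have hg0 : g = 0 := by
    by_contra hne
    obtain ⟨t, ht, htg⟩ := mem_contraction.1 hgc
    obtain ⟨b, hb, s, hs, hsb⟩ := exists_mem_support_restrictTo_le hne ht htg
    rw [mem_support_iff, hg, if_pos ⟨_, ⟨s, hs, rfl⟩, hsb⟩] at hb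
    exact hb rfl
  rwa [hg0, sub_zero] at hfg

lemma newtonPolyhedron_spanMonomials (G : Set (Fin r →₀ ℕ)) :
    newtonPolyhedron (spanMonomials k G) = upperHull (realExp '' G) := by
  refine Set.Subset.antisymm (convexHull_min ?_ (convex_upperHull _)) ?_
  · rintro _ ⟨α, hα, rfl⟩
    obtain ⟨s, hs, hsα⟩ := monomial_mem_spanMonomials.1 hα
    exact upperHull_mono_right (subset_upperHull _ ⟨s, hs, rfl⟩) fun i => Nat.cast_le.2 (hsα i)
  -- The orthant is the convex hull of its lattice points, and convex hulls commute with sums.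
  · have hIci : (Set.Ici 0 : Set (Fin r → ℝ)) ⊆
        convexHull ℝ (Set.pi Set.univ fun _ => Set.range ((↑) : ℕ → ℝ)) := by
      rw [convexHull_pi]
      intro x hx i _
      obtain ⟨N, hN⟩ := exists_nat_ge (x i)
      have hseg : x i ∈ segment ℝ (0 : ℝ) N := by
        rw [segment_eq_Icc N.cast_nonneg]
        exact ⟨hx i, hN⟩
      exact segment_subset_convexHull (Set.mem_range.2 ⟨0, Nat.cast_zero⟩) (Set.mem_range_self N) hseg
    rw [upperHull_eq_add]
    refine (Set.add_subset_add_left hIci).trans ?_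
    rw [← convexHull_add]
    refine convexHull_mono ?_
    rintro _ ⟨_, ⟨g, hg, rfl⟩, c, hc, rfl⟩
    choose m hm using fun i => hc i (Set.mem_univ i)
    refine ⟨g + Finsupp.equivFunOnFinite.symm m,
      monomial_mem_spanMonomials.2 ⟨g, hg, le_self_add⟩, ?_⟩
    ext i
    simp [realExp, hm]

lemma iInf_spanMonomials {ι : Type*} [Nonempty ι] (G : ι → Set (Fin r →₀ ℕ)) (n : ℕ) :
    ⨅ j, spanMonomials k (n • G j) = spanMonomials k (⋂ j, upperPow (G j) n) := by
  ext f
  simp only [Ideal.mem_iInf, mem_spanMonomials]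
  constructor
  · intro h α hα
    exact ⟨α, Set.mem_iInter.2 fun j => h j α hα, le_rfl⟩
  · intro h j α hα
    obtain ⟨s, hs, hsα⟩ := h α hα
    exact upperPow_mono_right (Set.mem_iInter.1 hs j) hsα

end MonomialIdeals

/-! ### The limit from linear bounds, and the comparison of constants -/

lemma tendsto_div_of_linear_bounds {D : ℕ → ℝ} {δ A B : ℝ}
    (h : ∀ n : ℕ, 1 ≤ n → δ * n - A ≤ D n ∧ D n ≤ δ * n + B) :
    Tendsto (fun n : ℕ => D n / n) atTop (𝓝 δ) := by
  have hA : Tendsto (fun n : ℕ => δ - A / n) atTop (𝓝 (δ - 0)) :=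
    tendsto_const_nhds.sub (tendsto_const_div_atTop_nhds_zero_nat A)
  have hB : Tendsto (fun n : ℕ => δ + B / n) atTop (𝓝 (δ + 0)) :=
    tendsto_const_nhds.add (tendsto_const_div_atTop_nhds_zero_nat B)
  rw [sub_zero] at hA
  rw [add_zero] at hB
  refine tendsto_of_tendsto_of_tendsto_of_le_of_le' hA hB ?_ ?_
  all_goals
    filter_upwards [eventually_ge_atTop 1] with n hn
    have hn0 : (0 : ℝ) < n := by exact_mod_cast hn
    obtain ⟨h1, h2⟩ := h n hn
  · rw [le_div_iff₀ hn0, sub_mul, div_mul_cancel₀ _ hn0.ne']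
    exact h1
  · rw [div_le_iff₀ hn0, add_mul, div_mul_cancel₀ _ hn0.ne']
    exact h2

lemma one_add_mul_le_sq_mul_pow {r d : ℕ} (hr : 0 < r) (hd : 1 ≤ d) :
    1 + ((r : ℝ) - 1) * d ≤ (r : ℝ) ^ 2 * (d : ℝ) ^ (r - 1) := by
  have hr1 : (1 : ℝ) ≤ r := by exact_mod_cast hr
  have hd1 : (1 : ℝ) ≤ d := by exact_mod_cast hd
  rcases Nat.lt_or_ge r 2 with h | h
  · obtain rfl : r = 1 := by omega
    simp
  · calc 1 + ((r : ℝ) - 1) * d ≤ r * d := by linarith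
      _ ≤ (r : ℝ) ^ 2 * (d : ℝ) ^ (r - 1) :=
        mul_le_mul (le_self_pow₀ hr1 two_ne_zero) (le_self_pow₀ hd1 (by omega)) (by linarith)
          (by positivity)

/-! ### Symbolic powers and the symbolic polyhedron in terms of exponents -/

section

open MvPolynomial

variable {k : Type*} [Field k] {r : ℕ}

lemma contraction_congr {R : Type*} [CommRing R] {p q : Ideal R} [p.IsPrime] [q.IsPrime]
    (h : p = q) (J : Ideal R) : contraction p J = contraction q J := by
  subst h
  rfl

lemma symbolicPower_spanMonomials {M : Set (Fin r →₀ ℕ)}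
    [Nonempty (spanMonomials k M).minimalPrimes]
    {F : (spanMonomials k M).minimalPrimes → Set (Fin r)}
    (hF : ∀ p : (spanMonomials k M).minimalPrimes,
      (p : Ideal (MvPolynomial (Fin r) k)) = Ideal.span (X '' F p)) (n : ℕ) :
    symbolicPower (spanMonomials k M) n =
      spanMonomials k (⋂ p, upperPow (restrictTo (F p) '' M) n) := by
  rw [← iInf_spanMonomials]
  refine iInf_congr fun p => ?_
  have : (p : Ideal (MvPolynomial (Fin r) k)).IsPrime := p.2.1.1
  refine (contraction_congr (hF p) _).trans ?_
  rw [spanMonomials_pow, contraction_spanMonomials, Set.image_nsmul]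

lemma symbolicPolyhedron_spanMonomials {M : Set (Fin r →₀ ℕ)}
    {F : (spanMonomials k M).minimalPrimes → Set (Fin r)}
    (hF : ∀ p : (spanMonomials k M).minimalPrimes,
      (p : Ideal (MvPolynomial (Fin r) k)) = Ideal.span (X '' F p)) :
    symbolicPolyhedron (spanMonomials k M) =
      ⋂ p, upperHull (realExp '' (restrictTo (F p) '' M)) := by
  rw [symbolicPolyhedron, minimalPrimaryComponents_eq, Set.biInter_range]
  refine Set.iInter_congr fun p => ?_
  have : (p : Ideal (MvPolynomial (Fin r) k)).IsPrime := p.2.1.1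
  rw [contraction_congr (hF p), contraction_spanMonomials, newtonPolyhedron_spanMonomials]

lemma le_symbolicPower {R : Type*} [CommRing R] (I : Ideal R) (n : ℕ) :
    I ^ n ≤ symbolicPower I n :=
  le_iInf fun _ => Ideal.le_comap_map

lemma isUpperSet_iInter_upperPow {ι : Type*} (G : ι → Set (Fin r →₀ ℕ)) (n : ℕ) :
    IsUpperSet (⋂ j, upperPow (G j) n) :=
  isUpperSet_iInter fun _ _ _ h hα => upperPow_mono_right hα h

lemma nonempty_of_spanMonomials_ne_bot {S : Set (Fin r →₀ ℕ)} (h : spanMonomials k S ≠ ⊥) :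
    S.Nonempty := by
  rw [Set.nonempty_iff_ne_empty]
  rintro rfl
  exact h (by simp [spanMonomials])

/-- A monomial ideal is generated by the monomials with minimal exponents. -/
lemma spanMonomials_minimal (S : Set (Fin r →₀ ℕ)) :
    spanMonomials k {β | Minimal (· ∈ upperClosure S) β} = spanMonomials k S := by
  refine spanMonomials_congr fun α => ⟨?_, ?_⟩
  · rintro ⟨β, hβ, hβα⟩
    obtain ⟨s, hs, hsβ⟩ := mem_upperClosure.1 hβ.prop
    exact ⟨s, hs, hsβ.trans hβα⟩
  · rintro ⟨s, hs, hsα⟩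
    obtain ⟨β, hβs, hβ⟩ := exists_minimal_le_of_wellFoundedLT (· ∈ upperClosure S) s
      (subset_upperClosure hs)
    exact ⟨β, hβ, hβs.trans hsα⟩

lemma spanMonomials_upperClosure (S : Set (Fin r →₀ ℕ)) :
    spanMonomials k (upperClosure S : Set (Fin r →₀ ℕ)) = spanMonomials k S := by
  refine spanMonomials_congr fun α => ⟨?_, ?_⟩
  · rintro ⟨β, hβ, hβα⟩
    obtain ⟨s, hs, hsβ⟩ := mem_upperClosure.1 hβ
    exact ⟨s, hs, hsβ.trans hβα⟩
  · rintro ⟨s, hs, hsα⟩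
    exact ⟨s, subset_upperClosure hs, hsα⟩

lemma spanMonomials_eq_top {S : Set (Fin r →₀ ℕ)} (h : (0 : Fin r →₀ ℕ) ∈ S) :
    spanMonomials k S = ⊤ :=
  (Ideal.eq_top_iff_one _).2 (mem_spanMonomials.2 fun _ _ => ⟨0, h, zero_le⟩)

end

end MonomialSymbolic

/-! ### Assembly of the theorem -/

open MonomialSymbolic in
theorem theorem3p2 {k : Type*} [Field k] {r : ℕ} (I : Ideal (MvPolynomial (Fin r) k))
    (hI : MonomialSymbolic.IsMonomialIdeal I) (hbot : I ≠ ⊥) (htop : I ≠ ⊤) :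
    -- the maxima `d(I)`, `d(I⁽ⁿ⁾)` and `δ(I)` exist
    IsGreatest (MonomialSymbolic.minGenDegrees I) (MonomialSymbolic.maxGenDegree I) ∧
    (∀ n : ℕ, IsGreatest
      (MonomialSymbolic.minGenDegrees (MonomialSymbolic.symbolicPower I n))
      (MonomialSymbolic.maxGenDegree (MonomialSymbolic.symbolicPower I n))) ∧
    IsGreatest (MonomialSymbolic.vertexSums I) (MonomialSymbolic.delta I) ∧
    -- the limit
    Tendsto (fun n : ℕ =>
        (MonomialSymbolic.maxGenDegree (MonomialSymbolic.symbolicPower I n) : ℝ) / (n : ℝ))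
      atTop (𝓝 (MonomialSymbolic.delta I)) ∧
    -- the explicit bounds
    ∀ n : ℕ, 1 ≤ n →
      MonomialSymbolic.delta I * n
          - r * ((r : ℝ) ^ 2 * (MonomialSymbolic.maxGenDegree I : ℝ) ^ (r - 1))
            * (1 + (I.minimalPrimes.ncard : ℝ) * ((r : ℝ) - 1) * MonomialSymbolic.maxGenDegree I)
        ≤ (MonomialSymbolic.maxGenDegree (MonomialSymbolic.symbolicPower I n) : ℝ) ∧
      (MonomialSymbolic.maxGenDegree (MonomialSymbolic.symbolicPower I n) : ℝ)
        ≤ MonomialSymbolic.delta I * n + r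
          + r * ((r : ℝ) - 1) * MonomialSymbolic.maxGenDegree I := by
  obtain ⟨S, hS⟩ := hI
  change I = spanMonomials k S at hS
  -- Passing to minimal generators makes all exponents bounded by `d(I)`, which an arbitrary `S`
  -- need not satisfy.
  set M : Set (Fin r →₀ ℕ) := {β | Minimal (· ∈ upperClosure S) β} with hM
  have hIU : I = spanMonomials k (upperClosure S : Set (Fin r →₀ ℕ)) := by
    rw [hS, spanMonomials_upperClosure]
  have hIM : I = spanMonomials k M := by rw [hS, spanMonomials_minimal]
  have hMne : M.Nonempty := nonempty_of_spanMonomials_ne_bot (hIM ▸ hbot)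
  have hMfin : M.Finite := WellQuasiOrderedLE.finite_of_isAntichain (setOfPred_minimal_antichain _)
  have h0M : (0 : Fin r →₀ ℕ) ∉ M := fun h => htop (hIM.trans (spanMonomials_eq_top h))
  have hgI : IsGreatest (minGenDegrees I) (maxGenDegree I) := by
    rw [hIU]
    exact isGreatest_maxGenDegree (upperClosure S).upper
      (nonempty_of_spanMonomials_ne_bot (hIU ▸ hbot))
  set d := maxGenDegree I with hd
  have hMd : ∀ β ∈ M, β.degree ≤ d := by
    intro β hβ
    refine hgI.2 ?_
    rw [hIU, minGenDegrees_spanMonomials (upperClosure S).upper]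
    exact ⟨β, hβ, rfl⟩
  have hMd' : ∀ β ∈ M, ∀ i, β i ≤ d := fun β hβ i => (Finsupp.le_degree i β).trans (hMd β hβ)
  obtain ⟨β₀, hβ₀⟩ := hMne
  have hβ₀0 : β₀ ≠ 0 := fun h => h0M (h ▸ hβ₀)
  have hr : 0 < r := by
    obtain ⟨i, -⟩ := Finsupp.ne_iff.1 hβ₀0
    exact i.pos
  have hd1 : 1 ≤ d := by
    rw [Nat.one_le_iff_ne_zero]
    intro h
    have := hMd _ hβ₀
    rw [h, Nat.le_zero, Finsupp.degree_eq_zero_iff] at this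
    exact hβ₀0 this
  clear_value d
  have hfinp : I.minimalPrimes.Finite := I.finite_minimalPrimes_of_isNoetherianRing
  have hnep : I.minimalPrimes.Nonempty :=
    Set.nonempty_coe_sort.1 (Ideal.nonempty_minimalPrimes htop)
  have hs : (1 : ℝ) ≤ I.minimalPrimes.ncard := by
    exact_mod_cast (Set.ncard_pos hfinp).2 hnep
  clear_value M
  clear hIU hS
  subst hIM
  have : Nonempty (spanMonomials k M).minimalPrimes := hnep.to_subtype
  have : Finite (spanMonomials k M).minimalPrimes := hfinp
  choose F hpF hFmin using fun p : (spanMonomials k M).minimalPrimes => exists_eq_span_X_image p.2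
  set G : (spanMonomials k M).minimalPrimes → Set (Fin r →₀ ℕ) :=
    fun p => restrictTo (F p) '' M with hG
  have hGfin : ∀ p, (G p).Finite := fun p => hMfin.image _
  have hGne : ∀ p, (G p).Nonempty := fun p => ⟨_, β₀, hβ₀, rfl⟩
  have hGd : ∀ p, ∀ g ∈ G p, ∀ i, g i ≤ d := by
    rintro p _ ⟨s, hs, rfl⟩ i
    exact (restrictTo_le _ s i).trans (hMd' s hs i)
  have hGF : ∀ p i, (∃ m ≤ d, Finsupp.single i m ∈ G p) ∨ ∀ g ∈ G p, g i = 0 := by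
    intro p i
    by_cases hi : i ∈ F p
    -- This generator involves no variable of `F p` other than `x_i`, so its restriction is a pure
    -- power.
    · obtain ⟨s, hs, hs0⟩ := hFmin p i hi
      refine Or.inl ⟨s i, hMd' s hs i, s, hs, ?_⟩
      ext l
      by_cases hli : l = i
      · subst hli
        rw [restrictTo_apply_of_mem hi, Finsupp.single_eq_same]
      · rw [Finsupp.single_eq_of_ne hli]
        by_cases hl : l ∈ F p
        · rw [restrictTo_apply_of_mem hl, hs0 l hl hli]
        · rw [restrictTo_apply_of_notMem hl]
    · right
      rintro _ ⟨s, -, rfl⟩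
      exact restrictTo_apply_of_notMem hi s
  have hsym : ∀ n, symbolicPower (spanMonomials k M) n =
      spanMonomials k (⋂ p, upperPow (G p) n) := symbolicPower_spanMonomials hpF
  have hpoly : symbolicPolyhedron (spanMonomials k M) = ⋂ p, upperHull (realExp '' G p) :=
    symbolicPolyhedron_spanMonomials hpF
  have hgn : ∀ n, IsGreatest (minGenDegrees (symbolicPower (spanMonomials k M) n))
      (maxGenDegree (symbolicPower (spanMonomials k M) n)) := by
    intro n
    have hne : symbolicPower (spanMonomials k M) n ≠ ⊥ := fun h =>
      pow_ne_zero n hbot (le_bot_iff.1 (h ▸ le_symbolicPower (spanMonomials k M) n))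
    rw [hsym] at hne ⊢
    exact isGreatest_maxGenDegree (isUpperSet_iInter_upperPow G n)
      (nonempty_of_spanMonomials_ne_bot hne)
  have hvs : vertexSums (spanMonomials k M) =
      (fun v : Fin r → ℝ => ∑ i, v i) '' (⋂ p, upperHull (realExp '' G p)).extremePoints ℝ := by
    ext c
    simp only [vertexSums, hpoly, Set.mem_image, eq_comm]
    rfl
  have hgδ : IsGreatest (vertexSums (spanMonomials k M)) (delta (spanMonomials k M)) := by
    have hfin : (vertexSums (spanMonomials k M)).Finite := by
      rw [hvs]
      exact (finite_extremePoints hGfin).image _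
    have hne : (vertexSums (spanMonomials k M)).Nonempty := by
      rw [hvs]
      exact (extremePoints_nonempty hGfin hGne).image _
    exact ⟨hne.csSup_mem hfin, fun c hc => le_csSup hfin.bddAbove hc⟩
  set δ := delta (spanMonomials k M)
  have hδ : ∀ v ∈ (⋂ p, upperHull (realExp '' G p)).extremePoints ℝ, ∑ i, v i ≤ δ :=
    fun v hv => hgδ.2 (hvs ▸ ⟨v, hv, rfl⟩)
  obtain ⟨v, hv, hvδ⟩ : ∃ v ∈ (⋂ p, upperHull (realExp '' G p)).extremePoints ℝ,
      ∑ i, v i = δ := by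
    have := hgδ.1
    rw [hvs] at this
    exact this
  have hbounds : ∀ n : ℕ, 1 ≤ n →
      δ * n - r * ((r : ℝ) ^ 2 * (d : ℝ) ^ (r - 1)) *
          (1 + ((spanMonomials k M).minimalPrimes.ncard : ℝ) * ((r : ℝ) - 1) * d)
        ≤ (maxGenDegree (symbolicPower (spanMonomials k M) n) : ℝ) ∧
      (maxGenDegree (symbolicPower (spanMonomials k M) n) : ℝ)
        ≤ δ * n + (r + r * ((r : ℝ) - 1) * d) := by
    intro n hn
    have hdeg := minGenDegrees_spanMonomials (k := k) (isUpperSet_iInter_upperPow G n)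
    rw [← hsym] at hdeg
    constructor
    · obtain ⟨β, hβ, hle⟩ := exists_minimal_le_sum hr hGfin hGne hGd hGF hv n
      have h1 : β.degree ≤ maxGenDegree (symbolicPower (spanMonomials k M) n) :=
        (hgn n).2 (hdeg ▸ ⟨β, hβ, rfl⟩)
      have h2 : ∑ i, (β i : ℝ) ≤ maxGenDegree (symbolicPower (spanMonomials k M) n) := by
        rw [Finsupp.degree_eq_sum] at h1
        exact_mod_cast h1
      rw [hvδ] at hle
      have hr1 : (0 : ℝ) ≤ (r : ℝ) - 1 := sub_nonneg.2 (by exact_mod_cast hr)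
      -- The sharper loss `r K²` is weakened to the stated one: one factor `K` is at most `ρ`, the
      -- other at most `1 + s (r - 1) d` because `s ≥ 1`.
      have h3 := one_add_mul_le_sq_mul_pow hr hd1
      have h4 : 1 + ((r : ℝ) - 1) * d ≤
          1 + ((spanMonomials k M).minimalPrimes.ncard : ℝ) * ((r : ℝ) - 1) * d := by
        rw [mul_assoc]
        have := le_mul_of_one_le_left (mul_nonneg hr1 (Nat.cast_nonneg d)) hs
        linarith
      have h5 : (0 : ℝ) ≤ 1 + ((r : ℝ) - 1) * d := by positivity
      have h6 := mul_le_mul_of_nonneg_left (mul_le_mul h3 h4 h5 (h5.trans h3))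
        (Nat.cast_nonneg (α := ℝ) r)
      rw [← mul_assoc, ← mul_assoc, ← mul_assoc] at h6
      refine le_trans ?_ (hle.trans h2)
      rw [sq, ← mul_assoc, ← mul_assoc]
      linarith
    · have h1 := (hgn n).1
      rw [hdeg] at h1
      obtain ⟨β, hβ, hβd⟩ := h1
      have h2 := sum_le_of_minimal hr hGfin hGne hGF hδ hn hβ
      rw [← hβd, Finsupp.degree_eq_sum]
      push_cast
      linarith
  refine ⟨hgI, hgn, hgδ, tendsto_div_of_linear_bounds hbounds, fun n hn => ?_⟩
  obtain ⟨h1, h2⟩ := hbounds n hn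
  exact ⟨h1, by linarith⟩
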